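/- Let $d\ge 1$ be an integer, $\mathcal S=\{s\in[0,1]^d:\|s\|_1\le 1\}$ with $\|s\|_1=\sum_{i=1}^d|s_i|$, and let $f:\mathcal S\to[0,\infty)$ be a probability density (with respect to Lebesgue measure) that is twice continuously differentiable on $\mathcal S$ (up to the boundary). Let $X_1,X_2,\dots$ be i.i.d. random vectors with density $f$. For $\alpha\in(0,\infty)^d$ and $\beta>0$ let $$K_{\alpha,\beta}(x)=\frac{\Gamma(\|\alpha\|_1+\beta)}{\Gamma(\beta)\prod_{i=1}^d\Gamma(\alpha_i)}\,(1-\|x\|_1)^{\beta-1}\prod_{i=1}^d x_i^{\alpha_i-1},\qquad x\in\mathcal S,$$ be the $\mathrm{Dirichlet}(\alpha,\beta)$ density, and for $n\ge1$, $b>0$ let $$\hat f_{n,b}(s)=\frac1n\sum_{k=1}^n K_{s/b+1,\,(1-\|s\|_1)/b+1}(X_k),\quad s\in\mathcal S,\qquad \mathrm{MISE}[\hat f_{n,b}]=\int_{\mathcal S}\mathbb E\big[|\hat f_{n,b}(s)-f(s)|^2\big]\,ds$$ (where $s/b+1=(s_1/b+1,\dots,s_d/b+1)$). Put $\psi(s)=\big[(4\pi)^d(1-\|s\|_1)\prod_{i=1}^d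 s_i\big]^{-1/2}$, $$g(s)=\sum_{i=1}^d(1-(d+1)s_i)\,\partial_i f(s)+\frac12\sum_{i,j=1}^d s_i(\mathbf 1_{\{i=j\}}-s_j)\,\partial_i\partial_j f(s),$$ $A=\int_{\mathcal S}\psi(s)f(s)\,ds$ and $B=\int_{\mathcal S}g(s)^2\,ds$. Then all these integrals and expectations are finite, and the following hold. (a) As $n\to\infty$ and $b\to0$ (with $b>0$), $$\mathrm{MISE}[\hat f_{n,b}]=n^{-1}b^{-d/2}A+b^2B+o(n^{-1}b^{-d/2})+o(b^2).$$ (b) Suppose $B>0$, and put $$b_{\mathrm{opt}}(n)=n^{-2/(d+4)}\Big[\frac d4\cdot\frac AB\Big]^{2/(d+4)}.$$ For each $n\ge1$, $b_{\mathrm{opt}}(n)$ is positive and is the unique minimizer over $b>0$ of the leading part $n^{-1}b^{-d/2}A+b^2B$. It is the asymptotically optimal bandwidth with respect to $\mathrm{MISE}$: for every sequence $b(n)$ that is eventually positive and tends to $0$, and every $\varepsilon>0$, one has $\mathrm{MISE}[\hat f_{n,b_{\mathrm{opt}}(n)}]\le(1+\varepsilon)\,\mathrm{MISE}[\hat f_{n,b(n)}]$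 for all large $n$; and if $\mathrm{MISE}[\hat f_{n,b(n)}]\sim\mathrm{MISE}[\hat f_{n,b_{\mathrm{opt}}(n)}]$, then $b(n)\sim b_{\mathrm{opt}}(n)$. Moreover, as $n\to\infty$, $$\mathrm{MISE}[\hat f_{n,b_{\mathrm{opt}}(n)}]=n^{-4/(d+4)}\left[\frac{1+\frac d4}{(\frac d4)^{d/(d+4)}}\right]\frac{A^{4/(d+4)}}{B^{-d/(d+4)}}+o(n^{-4/(d+4)}).$$ (c) If $n^{2/(d+4)}\,b(n)\to\lambda$ for some $\lambda>0$, then, as $n\to\infty$, $$\mathrm{MISE}[\hat f_{n,b(n)}]=n^{-4/(d+4)}\big[\lambda^{-d/2}A+\lambda^2B\big]+o(n^{-4/(d+4)}).$$ -/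

import Mathlib

open MeasureTheory ProbabilityTheory Filter Topology Asymptotics

noncomputable section

namespace DirichletKernel

/-- The `ℓ¹` norm on `ℝ^d`. -/
def l1 {d : ℕ} (s : Fin d → ℝ) : ℝ := ∑ i, |s i|

/-- The `d`-dimensional (full, closed) simplex `{s ∈ [0,1]^d : ‖s‖₁ ≤ 1}`. -/
def simplex (d : ℕ) : Set (Fin d → ℝ) :=
  {s | (∀ i, s i ∈ Set.Icc (0 : ℝ) 1) ∧ l1 s ≤ 1}

/-- The density of the `Dirichlet(α, β)` distribution on the simplex. -/
def dirichletDensity {d : ℕ} (α : Fin d → ℝ) (β : ℝ) (s : Fin d → ℝ) : ℝ :=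
  Real.Gamma (l1 α + β) / (Real.Gamma β * ∏ i, Real.Gamma (α i)) *
    ((1 - l1 s) ^ (β - 1) * ∏ i, s i ^ (α i - 1))

/-- The Dirichlet kernel estimator at the point `s`, with bandwidth `b`,
computed from the observations `x 0, …, x (n - 1)`. -/
def estimator {d : ℕ} (n : ℕ) (b : ℝ) (x : ℕ → Fin d → ℝ) (s : Fin d → ℝ) : ℝ :=
  (1 / (n : ℝ)) * ∑ k ∈ Finset.range n,
    dirichletDensity (fun i => s i / b + 1) ((1 - l1 s) / b + 1) (x k)

/-- The mean squared error `E[|f̂_{n,b}(s) - f(s)|²]` of the estimator at `s`. -/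
def mse {d : ℕ} {Ω : Type*} [MeasurableSpace Ω] (P : Measure Ω) (X : ℕ → Ω → Fin d → ℝ)
    (f : (Fin d → ℝ) → ℝ) (n : ℕ) (b : ℝ) (s : Fin d → ℝ) : ℝ :=
  ∫ ω, |estimator n b (fun k => X k ω) s - f s| ^ 2 ∂P

/-- The mean integrated squared error of the estimator. -/
def mise {d : ℕ} {Ω : Type*} [MeasurableSpace Ω] (P : Measure Ω) (X : ℕ → Ω → Fin d → ℝ)
    (f : (Fin d → ℝ) → ℝ) (n : ℕ) (b : ℝ) : ℝ :=
  ∫ s in simplex d, mse P X f n b s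

/-- The `i`-th partial derivative on the simplex (the ordinary one at interior points, and the
one determined by the values of the function on the simplex at boundary points). -/
def pderiv {d : ℕ} (i : Fin d) (f : (Fin d → ℝ) → ℝ) (s : Fin d → ℝ) : ℝ :=
  fderivWithin ℝ f (simplex d) s (Pi.single i 1)

/-- The first order coefficient of the bias. -/
def biasCoeff {d : ℕ} (f : (Fin d → ℝ) → ℝ) (s : Fin d → ℝ) : ℝ :=
  ∑ i, (1 - ((d : ℝ) + 1) * s i) * pderiv i f s +
    (1 / 2) * ∑ i, ∑ j, s i * ((if i = j then 1 else 0) - s j) * pderiv i (pderiv j f) s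

/-- `ψ(s) = [(4π)^d (1 - ‖s‖₁) ∏ i, s i]^{-1/2}`. -/
def psi {d : ℕ} (s : Fin d → ℝ) : ℝ :=
  ((4 * Real.pi) ^ d * (1 - l1 s) * ∏ i, s i) ^ (-(1 / 2) : ℝ)

/-- The leading part `n⁻¹ b^{-d/2} A + b² B` of the mean integrated squared error. -/
def leading (d : ℕ) (A B : ℝ) (n : ℕ) (b : ℝ) : ℝ :=
  (n : ℝ)⁻¹ * b ^ (-((d : ℝ) / 2)) * A + b ^ 2 * B

/-- The bandwidth `n^{-2/(d+4)} [(d/4) (A/B)]^{2/(d+4)}`. -/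
def optBandwidth (d : ℕ) (A B : ℝ) (n : ℕ) : ℝ :=
  (n : ℝ) ^ (-(2 / ((d : ℝ) + 4))) * (((d : ℝ) / 4) * (A / B)) ^ (2 / ((d : ℝ) + 4))

/-- A bandwidth sequence: eventually positive, and tending to `0`. -/
def IsBandwidth (b : ℕ → ℝ) : Prop :=
  (∀ᶠ n in atTop, 0 < b n) ∧ Tendsto b atTop (𝓝 0)

/-- The bandwidth sequence `β` is asymptotically optimal for the criterion `M n b` (to be made
small): no bandwidth sequence does better than `β` by a factor that stays away from `1`,
and every bandwidth sequence that does as well as `β` is asymptotically equivalent to `β`. -/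
def IsAsymptoticallyOptimal (M : ℕ → ℝ → ℝ) (β : ℕ → ℝ) : Prop :=
  IsBandwidth β ∧
  ∀ b : ℕ → ℝ, IsBandwidth b →
    (∀ ε : ℝ, 0 < ε → ∀ᶠ n in atTop, M n (β n) ≤ (1 + ε) * M n (b n)) ∧
    ((fun n => M n (b n)) ~[atTop] (fun n => M n (β n)) → b ~[atTop] β)

end DirichletKernel

end

/-!
The expectation of the estimator at `s` is the integral of `f` against the Dirichlet law with
parameters `s / b + 1` and `(1 - ‖s‖₁) / b + 1`. The values of a Stein operator have mean zero under
that law, which determines its moments about `s`: those of degree `2 m` are `O(b ^ m)` uniformly in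
`s`, and those of degree one and two are `b (1 - (d + 1) sᵢ)` and `b sᵢ (1_{i = j} - sⱼ)` up to
`o(b)`. By a second-order Taylor expansion of `f`, the bias divided by `b` is bounded and converges
pointwise to `biasCoeff f`, so dominated convergence gives the integrated squared bias.

The square of the kernel with bandwidth `b` is a constant multiple of the kernel with bandwidth
`b / 2`. By Legendre's duplication formula the constant is governed by ratios
`Γ (x + 1 / 2) / Γ (x + 1)`; log-convexity of `Γ` shows that, times `b ^ (d / 2)`, it converges to
`psi s` and is dominated by a multiple of `psi s`, which is integrable by the Dirichlet integral.
This gives the variance term; the squared mean is of lower order because `d ≥ 1`.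

With `t = b / b_opt`, the leading part is `b_opt ^ 2 B (4 / d * t ^ (-d / 2) + t ^ 2)`, which
exceeds its value at `t = 1` by at least a fixed multiple of `b_opt ^ 2 B (log t) ^ 2`. Hence
`b_opt` is the unique minimiser, and a bandwidth with asymptotically the same error must satisfy
`log t → 0`.
-/

namespace DirichletKernel

variable {d : ℕ}

/-! ### The Dirichlet integral -/

theorem lintegral_rpow_mul_sub_rpow {α β c : ℝ} (hα : 0 < α) (hβ : 0 < β) (hc : 0 < c) :
    ∫⁻ x in Set.Icc 0 c, ENNReal.ofReal (x ^ (α - 1) * (c - x) ^ (β - 1)) =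
      ENNReal.ofReal (c ^ (α + β - 1) * beta α β) := by
  have hbeta := beta_pos hα hβ
  have image_Ioo : (c * ·) '' Set.Ioo 0 1 = Set.Ioo 0 c := by
    rw [Set.image_mul_left_Ioo hc, mul_zero, mul_one]
  have rescale : ∀ t ∈ Set.Ioo (0 : ℝ) 1,
      ENNReal.ofReal |c| * ENNReal.ofReal ((c * t) ^ (α - 1) * (c - c * t) ^ (β - 1)) =
        ENNReal.ofReal (c ^ (α + β - 1) * beta α β) *
          ENNReal.ofReal (1 / beta α β * t ^ (α - 1) * (1 - t) ^ (β - 1)) := by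
    rintro t ⟨ht0, ht1⟩
    have hpow : c ^ (α + β - 1) = c * (c ^ (α - 1) * c ^ (β - 1)) := by
      rw [← Real.rpow_add hc, mul_comm, ← Real.rpow_add_one hc.ne']
      ring_nf
    rw [← ENNReal.ofReal_mul (abs_nonneg c), ← ENNReal.ofReal_mul (by positivity), abs_of_pos hc,
      ← mul_one_sub, Real.mul_rpow hc.le ht0.le, Real.mul_rpow hc.le (sub_pos.2 ht1).le, hpow]
    congr 1
    field_simp
  rw [← restrict_Ioo_eq_restrict_Icc, ← image_Ioo,
    lintegral_image_eq_lintegral_abs_deriv_mul measurableSet_Ioo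
      (fun t _ => by simpa using (hasDerivWithinAt_id t (Set.Ioo 0 1)).const_mul c)
      (mul_right_injective₀ hc.ne').injOn,
    setLIntegral_congr_fun measurableSet_Ioo rescale,
    lintegral_const_mul' _ _ ENNReal.ofReal_ne_top, ← lintegral_betaPDF,
    lintegral_betaPDF_eq_one hα hβ, mul_one]

/-- The simplex `{y | 0 ≤ y, ∑ i, y i ≤ c}` of size `c`, whose slices are simplices again. -/
def scaledSimplex (d : ℕ) (c : ℝ) : Set (Fin d → ℝ) := {y | (∀ i, 0 ≤ y i) ∧ ∑ i, y i ≤ c}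

theorem measurableSet_scaledSimplex (d : ℕ) (c : ℝ) : MeasurableSet (scaledSimplex d c) := by
  unfold scaledSimplex
  measurability

theorem cons_mem_scaledSimplex_iff {c x : ℝ} {y : Fin d → ℝ} :
    (Fin.cons x y : Fin (d + 1) → ℝ) ∈ scaledSimplex (d + 1) c ↔
      x ∈ Set.Icc 0 c ∧ y ∈ scaledSimplex d (c - x) := by
  simp only [scaledSimplex, Set.mem_ofPred_eq, Fin.forall_fin_succ, Fin.sum_univ_succ,
    Fin.cons_zero, Fin.cons_succ, Set.mem_Icc]
  refine ⟨fun ⟨⟨hx, hy⟩, hsum⟩ => ?_, fun ⟨⟨hx, _⟩, hy, hsum⟩ => ⟨⟨hx, hy⟩, ?_⟩⟩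
  · have hsum_nonneg : 0 ≤ ∑ i, y i := Finset.sum_nonneg fun i _ => hy i
    exact ⟨⟨hx, by linarith [hsum]⟩, hy, by linarith [hsum]⟩
  · linarith [hsum]

theorem lintegral_fin_cons {F : (Fin (d + 1) → ℝ) → ENNReal} (hF : Measurable F) :
    ∫⁻ z, F z = ∫⁻ x : ℝ, ∫⁻ y : Fin d → ℝ, F (Fin.cons x y) := by
  have hmp := (volume_preserving_piFinSuccAbove (fun _ : Fin (d + 1) => ℝ) 0).symm
  have hcons : ∀ p : ℝ × (Fin d → ℝ),
      (MeasurableEquiv.piFinSuccAbove (fun _ : Fin (d + 1) => ℝ) 0).symm p =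
        (Fin.cons p.1 p.2 : Fin (d + 1) → ℝ) := fun p => by
    simp [MeasurableEquiv.piFinSuccAbove, Fin.consEquiv]
  have hmeas := hF.comp hmp.measurable
  simp only [Function.comp_def, hcons] at hmeas
  rw [← hmp.lintegral_comp_emb (MeasurableEquiv.measurableEmbedding _)]
  simp only [hcons]
  exact lintegral_prod _ hmeas.aemeasurable

theorem lintegral_scaledSimplex_succ {c : ℝ} {F : (Fin (d + 1) → ℝ) → ENNReal}
    (hF : Measurable F) :
    ∫⁻ z in scaledSimplex (d + 1) c, F z =
      ∫⁻ x in Set.Icc 0 c, ∫⁻ y in scaledSimplex d (c - x), F (Fin.cons x y) := by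
  rw [← lintegral_indicator (measurableSet_scaledSimplex _ _),
    lintegral_fin_cons (hF.indicator (measurableSet_scaledSimplex _ _)),
    ← lintegral_indicator measurableSet_Icc]
  refine lintegral_congr fun x => ?_
  by_cases hx : x ∈ Set.Icc 0 c
  · rw [Set.indicator_of_mem hx, ← lintegral_indicator (measurableSet_scaledSimplex _ _)]
    refine lintegral_congr fun y => ?_
    by_cases hy : y ∈ scaledSimplex d (c - x)
    · rw [Set.indicator_of_mem hy, Set.indicator_of_mem (cons_mem_scaledSimplex_iff.2 ⟨hx, hy⟩)]
    · rw [Set.indicator_of_notMem hy,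
        Set.indicator_of_notMem fun h => hy (cons_mem_scaledSimplex_iff.1 h).2]
  · rw [Set.indicator_of_notMem hx]
    simp [Set.indicator_of_notMem fun h => hx (cons_mem_scaledSimplex_iff.1 h).1]

theorem lintegral_scaledSimplex_prod_rpow {α : Fin d → ℝ} {β c : ℝ} (hα : ∀ i, 0 < α i)
    (hβ : 0 < β) (hc : 0 < c) :
    ∫⁻ y in scaledSimplex d c, ENNReal.ofReal ((c - ∑ i, y i) ^ (β - 1) * ∏ i, y i ^ (α i - 1)) =
      ENNReal.ofReal (c ^ (∑ i, α i + β - 1) *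
        (Real.Gamma β * (∏ i, Real.Gamma (α i)) / Real.Gamma (∑ i, α i + β))) := by
  induction d generalizing c with
  | zero =>
    have huniv : scaledSimplex 0 c = Set.univ := Set.eq_univ_of_forall fun y => by
      simp [scaledSimplex, hc.le]
    simp [huniv, (Real.Gamma_pos_of_pos hβ).ne', volume_pi]
  | succ d ih =>
    have hpos : 0 < ∑ i : Fin d, α i.succ + β :=
      add_pos_of_nonneg_of_pos (Finset.sum_nonneg fun i _ => (hα _).le) hβ
    set K : ℝ := Real.Gamma β * (∏ i : Fin d, Real.Gamma (α i.succ)) /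
      Real.Gamma (∑ i : Fin d, α i.succ + β) with hK
    have hK0 : 0 ≤ K := div_nonneg (mul_nonneg (Real.Gamma_pos_of_pos hβ).le
      (Finset.prod_nonneg fun i _ => (Real.Gamma_pos_of_pos (hα _)).le))
      (Real.Gamma_pos_of_pos hpos).le
    have slice : ∀ x ∈ Set.Ioo 0 c, ∫⁻ y in scaledSimplex d (c - x), ENNReal.ofReal
        ((c - ∑ i, (Fin.cons x y : Fin (d + 1) → ℝ) i) ^ (β - 1) *
          ∏ i, (Fin.cons x y : Fin (d + 1) → ℝ) i ^ (α i - 1)) =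
        ENNReal.ofReal K *
          ENNReal.ofReal (x ^ (α 0 - 1) * (c - x) ^ (∑ i : Fin d, α i.succ + β - 1)) := by
      rintro x ⟨hx0, hxc⟩
      simp only [Fin.sum_univ_succ, Fin.prod_univ_succ, Fin.cons_zero, Fin.cons_succ,
        ← sub_sub, mul_left_comm _ (x ^ (α 0 - 1)),
        ENNReal.ofReal_mul (Real.rpow_nonneg hx0.le (α 0 - 1))]
      rw [lintegral_const_mul' _ _ ENNReal.ofReal_ne_top, ih (fun i => hα i.succ) (sub_pos.2 hxc),
        mul_comm _ (Real.Gamma β * _ / _), ENNReal.ofReal_mul hK0, mul_left_comm]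
    rw [lintegral_scaledSimplex_succ (by fun_prop), ← restrict_Ioo_eq_restrict_Icc,
      setLIntegral_congr_fun measurableSet_Ioo slice,
      lintegral_const_mul' _ _ ENNReal.ofReal_ne_top, restrict_Ioo_eq_restrict_Icc,
      lintegral_rpow_mul_sub_rpow (hα 0) hpos hc, ← ENNReal.ofReal_mul hK0, Fin.sum_univ_succ,
      Fin.prod_univ_succ, beta, hK, add_assoc]
    congr 1
    have := (Real.Gamma_pos_of_pos hpos).ne'
    field_simp

/-! ### The simplex -/

theorem l1_eq_sum {s : Fin d → ℝ} (hs : ∀ i, 0 ≤ s i) : l1 s = ∑ i, s i :=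
  Finset.sum_congr rfl fun i _ => abs_of_nonneg (hs i)

theorem l1_nonneg (s : Fin d → ℝ) : 0 ≤ l1 s := Finset.sum_nonneg fun _ _ => abs_nonneg _

theorem measurable_l1 : Measurable (l1 : (Fin d → ℝ) → ℝ) := by unfold l1; fun_prop

theorem coord_nonneg_of_mem_simplex {s : Fin d → ℝ} (hs : s ∈ simplex d) (i : Fin d) : 0 ≤ s i :=
  (hs.1 i).1

theorem l1_eq_sum_of_mem_simplex {s : Fin d → ℝ} (hs : s ∈ simplex d) : l1 s = ∑ i, s i :=
  l1_eq_sum (coord_nonneg_of_mem_simplex hs)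

theorem one_sub_l1_nonneg {s : Fin d → ℝ} (hs : s ∈ simplex d) : 0 ≤ 1 - l1 s := sub_nonneg.2 hs.2

theorem simplex_eq_scaledSimplex : simplex d = scaledSimplex d 1 := by
  ext s
  refine ⟨fun hs => ⟨coord_nonneg_of_mem_simplex hs, ?_⟩,
    fun hs => ⟨fun i => ⟨hs.1 i, ?_⟩, (l1_eq_sum hs.1).trans_le hs.2⟩⟩
  · exact (l1_eq_sum_of_mem_simplex hs).symm.trans_le hs.2
  · exact (Finset.single_le_sum (fun j _ => hs.1 j) (Finset.mem_univ i)).trans hs.2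

theorem measurableSet_simplex : MeasurableSet (simplex d) :=
  simplex_eq_scaledSimplex ▸ measurableSet_scaledSimplex d 1

theorem isCompact_simplex : IsCompact (simplex d) := by
  have h : simplex d = Set.pi Set.univ (fun _ => Set.Icc (0 : ℝ) 1) ∩ {s | l1 s ≤ 1} := by
    ext s
    simp [simplex, Pi.le_def, forall_and]
  rw [h]
  exact (isCompact_univ_pi fun _ => isCompact_Icc).inter_right
    (isClosed_le (by unfold l1; fun_prop) continuous_const)

theorem convex_simplex : Convex ℝ (simplex d) := by
  have h : simplex d = (⋂ i, {s | 0 ≤ LinearMap.proj (R := ℝ) (φ := fun _ : Fin d => ℝ) i s}) ∩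
      {s | (∑ i, LinearMap.proj (R := ℝ) (φ := fun _ : Fin d => ℝ) i) s ≤ 1} := by
    ext s
    simp [simplex_eq_scaledSimplex, scaledSimplex]
  rw [h]
  exact (convex_iInter fun i => convex_halfSpace_ge (LinearMap.isLinear _) 0).inter
    (convex_halfSpace_le (LinearMap.isLinear _) 1)

theorem exists_abs_le_of_continuousOn_simplex {h : (Fin d → ℝ) → ℝ}
    (hh : ContinuousOn h (simplex d)) : ∃ C, 0 ≤ C ∧ ∀ x ∈ simplex d, |h x| ≤ C := by
  obtain ⟨C, hC⟩ := isCompact_simplex.exists_bound_of_continuousOn hh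
  exact ⟨max C 0, le_max_right _ _, fun x hx => (hC x hx).trans (le_max_left _ _)⟩

/-! ### The Dirichlet distribution -/

section Dirichlet

variable {α : Fin d → ℝ} {β : ℝ}

theorem measurable_Gamma : Measurable Real.Gamma := by
  refine measurable_of_measurable_on_compl_countable (Set.range fun m : ℕ => -(m : ℝ))
    (Set.countable_range _) (ContinuousOn.domRestrict fun x hx => ?_).measurable
  exact (Real.differentiableAt_Gamma fun m hm => hx ⟨m, hm.symm⟩).continuousAt.continuousWithinAt

theorem measurable_dirichletDensity_comp {T : Type*} [MeasurableSpace T] {a : T → Fin d → ℝ}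
    {b : T → ℝ} {x : T → Fin d → ℝ} (ha : Measurable a) (hb : Measurable b) (hx : Measurable x) :
    Measurable fun t => dirichletDensity (a t) (b t) (x t) := by
  have hl1 := measurable_l1 (d := d)
  have hΓ := measurable_Gamma
  unfold dirichletDensity
  fun_prop

theorem measurable_dirichletDensity (α : Fin d → ℝ) (β : ℝ) :
    Measurable (dirichletDensity α β) :=
  measurable_dirichletDensity_comp measurable_const measurable_const measurable_id

theorem dirichletDensity_nonneg (hα : ∀ i, 0 < α i) (hβ : 0 < β) {x : Fin d → ℝ}
    (hx : x ∈ simplex d) : 0 ≤ dirichletDensity α β x := by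
  have hΓ : 0 < Real.Gamma (l1 α + β) :=
    Real.Gamma_pos_of_pos (add_pos_of_nonneg_of_pos (l1_nonneg α) hβ)
  have hΓα : 0 ≤ ∏ i, Real.Gamma (α i) :=
    Finset.prod_nonneg fun i _ => (Real.Gamma_pos_of_pos (hα i)).le
  have hpow : 0 ≤ ∏ i, x i ^ (α i - 1) :=
    Finset.prod_nonneg fun i _ => Real.rpow_nonneg (coord_nonneg_of_mem_simplex hx i) _
  exact mul_nonneg (div_nonneg hΓ.le (mul_nonneg (Real.Gamma_pos_of_pos hβ).le hΓα))
    (mul_nonneg (Real.rpow_nonneg (one_sub_l1_nonneg hx) _) hpow)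

theorem lintegral_dirichletDensity (hα : ∀ i, 0 < α i) (hβ : 0 < β) :
    ∫⁻ x in simplex d, ENNReal.ofReal (dirichletDensity α β x) = 1 := by
  have hΓ : 0 < Real.Gamma (∑ i, α i + β) := Real.Gamma_pos_of_pos
    (add_pos_of_nonneg_of_pos (Finset.sum_nonneg fun i _ => (hα i).le) hβ)
  have hΓβ := Real.Gamma_pos_of_pos hβ
  have hΓα : 0 < ∏ i, Real.Gamma (α i) := Finset.prod_pos fun i _ => Real.Gamma_pos_of_pos (hα i)
  set K := Real.Gamma (∑ i, α i + β) / (Real.Gamma β * ∏ i, Real.Gamma (α i)) with hK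
  have hK0 : 0 ≤ K := div_nonneg hΓ.le (mul_pos hΓβ hΓα).le
  have factor : ∀ x ∈ simplex d, ENNReal.ofReal (dirichletDensity α β x) = ENNReal.ofReal K *
      ENNReal.ofReal ((1 - ∑ i, x i) ^ (β - 1) * ∏ i, x i ^ (α i - 1)) := fun x hx => by
    rw [← ENNReal.ofReal_mul hK0, dirichletDensity, l1_eq_sum_of_mem_simplex hx,
      l1_eq_sum fun i => (hα i).le]
  rw [setLIntegral_congr_fun measurableSet_simplex factor,
    lintegral_const_mul' _ _ ENNReal.ofReal_ne_top, simplex_eq_scaledSimplex,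
    lintegral_scaledSimplex_prod_rpow hα hβ one_pos, ← ENNReal.ofReal_mul hK0, Real.one_rpow,
    one_mul, hK, div_mul_div_cancel₀ (mul_pos hΓβ hΓα).ne', div_self hΓ.ne', ENNReal.ofReal_one]

/-- The measure on the ambient space that is carried by the simplex and has density `f` there. -/
noncomputable def densityMeasure (f : (Fin d → ℝ) → ℝ) : Measure (Fin d → ℝ) :=
  (volume.restrict (simplex d)).withDensity fun x => ENNReal.ofReal (f x)

theorem densityMeasure_univ (f : (Fin d → ℝ) → ℝ) :
    densityMeasure f Set.univ = ∫⁻ x in simplex d, ENNReal.ofReal (f x) := by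
  rw [densityMeasure, withDensity_apply _ MeasurableSet.univ, Measure.restrict_univ]

theorem densityMeasure_absolutelyContinuous (f : (Fin d → ℝ) → ℝ) :
    densityMeasure f ≪ volume.restrict (simplex d) :=
  withDensity_absolutelyContinuous _ _

theorem ae_densityMeasure_mem_simplex (f : (Fin d → ℝ) → ℝ) :
    ∀ᵐ x ∂(densityMeasure f), x ∈ simplex d :=
  (densityMeasure_absolutelyContinuous f).ae_le (ae_restrict_mem measurableSet_simplex)

theorem integral_densityMeasure {f : (Fin d → ℝ) → ℝ} (hf_nonneg : ∀ x ∈ simplex d, 0 ≤ f x)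
    (hf : AEMeasurable f (volume.restrict (simplex d))) (h : (Fin d → ℝ) → ℝ) :
    ∫ x, h x ∂(densityMeasure f) = ∫ x in simplex d, f x * h x := by
  rw [densityMeasure, integral_withDensity_eq_integral_toReal_smul₀ hf.ennreal_ofReal
    (ae_of_all _ fun _ => ENNReal.ofReal_lt_top)]
  refine setIntegral_congr_fun measurableSet_simplex fun x hx => ?_
  simp only [smul_eq_mul, ENNReal.toReal_ofReal (hf_nonneg x hx)]

/-- The Dirichlet distribution with parameters `α` and `β`, as a measure on the ambient space. -/
noncomputable def dirichletMeasure (α : Fin d → ℝ) (β : ℝ) : Measure (Fin d → ℝ) :=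
  densityMeasure (dirichletDensity α β)

theorem isProbabilityMeasure_dirichletMeasure (hα : ∀ i, 0 < α i) (hβ : 0 < β) :
    IsProbabilityMeasure (dirichletMeasure α β) :=
  ⟨by rw [dirichletMeasure, densityMeasure_univ, lintegral_dirichletDensity hα hβ]⟩

theorem integrableOn_dirichletDensity (hα : ∀ i, 0 < α i) (hβ : 0 < β) :
    IntegrableOn (dirichletDensity α β) (simplex d) := by
  refine ⟨(measurable_dirichletDensity α β).aestronglyMeasurable, ?_⟩
  rw [hasFiniteIntegral_iff_ofReal ((ae_restrict_mem measurableSet_simplex).mono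
    fun x hx => dirichletDensity_nonneg hα hβ hx), lintegral_dirichletDensity hα hβ]
  exact ENNReal.one_lt_top

theorem integral_dirichletMeasure (hα : ∀ i, 0 < α i) (hβ : 0 < β) (h : (Fin d → ℝ) → ℝ) :
    ∫ x, h x ∂(dirichletMeasure α β) = ∫ x in simplex d, dirichletDensity α β x * h x :=
  integral_densityMeasure (fun _ => dirichletDensity_nonneg hα hβ)
    (measurable_dirichletDensity α β).aemeasurable h

theorem integrable_dirichletMeasure (hα : ∀ i, 0 < α i) (hβ : 0 < β) {h : (Fin d → ℝ) → ℝ}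
    (hh : ContinuousOn h (simplex d)) : Integrable h (dirichletMeasure α β) := by
  have := isProbabilityMeasure_dirichletMeasure hα hβ
  obtain ⟨C, -, hC⟩ := exists_abs_le_of_continuousOn_simplex hh
  exact .of_bound ((hh.aestronglyMeasurable measurableSet_simplex).mono_ac
    (densityMeasure_absolutelyContinuous _)) C ((ae_densityMeasure_mem_simplex _).mono hC)

/-! ### Moments of the Dirichlet distribution -/

theorem update_add_one_pos (hα : ∀ i, 0 < α i) (i j : Fin d) :
    0 < Function.update α i (α i + 1) j := by
  rw [Function.update_apply]
  split_ifs
  · exact add_pos (hα i) one_pos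
  · exact hα j

theorem l1_update_add_one {i : Fin d} (hi : 0 ≤ α i) :
    l1 (Function.update α i (α i + 1)) = l1 α + 1 := by
  have h (j : Fin d) : |Function.update α i (α i + 1) j| = |α j| + if j = i then 1 else 0 := by
    rcases eq_or_ne j i with rfl | hj
    · rw [Function.update_self, abs_of_nonneg hi, abs_of_nonneg (by positivity), if_pos rfl]
    · rw [Function.update_of_ne hj, if_neg hj, add_zero]
  simp [l1, h, Finset.sum_add_distrib]

theorem prod_update_eq_mul_prod_erase (F : Fin d → ℝ → ℝ) (α : Fin d → ℝ) (i : Fin d) (a : ℝ) :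
    ∏ j, F j (Function.update α i a j) = F i a * ∏ j ∈ Finset.univ.erase i, F j (α j) := by
  rw [← Finset.mul_prod_erase _ _ (Finset.mem_univ i), Function.update_self]
  congr 1
  refine Finset.prod_congr rfl fun j hj => ?_
  rw [Function.update_of_ne (Finset.ne_of_mem_erase hj)]

theorem dirichletDensity_mul_coord (hα : ∀ i, 0 < α i) (hβ : 0 < β) {x : Fin d → ℝ}
    (hx : x ∈ simplex d) (i : Fin d) :
    dirichletDensity α β x * x i = α i / (l1 α + β) *
      dirichletDensity (Function.update α i (α i + 1)) β x := by
  have hsum : 0 < l1 α + β := add_pos_of_nonneg_of_pos (l1_nonneg α) hβ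
  have hΓ := (Real.Gamma_pos_of_pos hsum).ne'
  have hΓβ := (Real.Gamma_pos_of_pos hβ).ne'
  have hΓi := (Real.Gamma_pos_of_pos (hα i)).ne'
  have hΓerase : ∏ j ∈ Finset.univ.erase i, Real.Gamma (α j) ≠ 0 :=
    Finset.prod_ne_zero_iff.2 fun j _ => (Real.Gamma_pos_of_pos (hα j)).ne'
  have hαi := (hα i).ne'
  have hpow : x i ^ (α i + 1 - 1) = x i ^ (α i - 1) * x i := by
    rw [← Real.rpow_add_one' (coord_nonneg_of_mem_simplex hx i) (by simpa using hαi)]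
    ring_nf
  rw [dirichletDensity, dirichletDensity, l1_update_add_one (hα i).le,
    prod_update_eq_mul_prod_erase fun _ a => Real.Gamma a,
    prod_update_eq_mul_prod_erase fun j a => x j ^ (a - 1),
    ← Finset.mul_prod_erase _ (fun j => Real.Gamma (α j)) (Finset.mem_univ i),
    ← Finset.mul_prod_erase _ (fun j => x j ^ (α j - 1)) (Finset.mem_univ i), add_right_comm,
    Real.Gamma_add_one hsum.ne', Real.Gamma_add_one hαi, hpow]
  field_simp

theorem integral_coord_mul_dirichletMeasure (hα : ∀ i, 0 < α i) (hβ : 0 < β) (i : Fin d)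
    (h : (Fin d → ℝ) → ℝ) :
    ∫ x, x i * h x ∂(dirichletMeasure α β) = α i / (l1 α + β) *
      ∫ x, h x ∂(dirichletMeasure (Function.update α i (α i + 1)) β) := by
  rw [integral_dirichletMeasure hα hβ, integral_dirichletMeasure (update_add_one_pos hα i) hβ,
    ← integral_const_mul]
  refine setIntegral_congr_fun measurableSet_simplex fun x hx => ?_
  rw [← mul_assoc, dirichletDensity_mul_coord hα hβ hx, mul_assoc]

theorem integral_coord_dirichletMeasure (hα : ∀ i, 0 < α i) (hβ : 0 < β) (i : Fin d) :
    ∫ x, x i ∂(dirichletMeasure α β) = α i / (l1 α + β) := by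
  have := isProbabilityMeasure_dirichletMeasure (update_add_one_pos hα i) hβ
  simpa using integral_coord_mul_dirichletMeasure hα hβ i fun _ => 1

/-- The `i`-th Stein operator of the Dirichlet distribution, on polynomials: the functions in its
range have mean zero, which expresses the moments of a given degree through lower ones. -/
noncomputable def steinOperator (α : Fin d → ℝ) (β : ℝ) (i : Fin d) (p : MvPolynomial (Fin d) ℝ)
    (x : Fin d → ℝ) : ℝ :=
  ((l1 α + β) * x i - α i) * p.eval x -
    x i * ((p.pderiv i).eval x - ∑ j, x j * (p.pderiv j).eval x)

theorem continuous_steinOperator (α : Fin d → ℝ) (β : ℝ) (i : Fin d)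
    (p : MvPolynomial (Fin d) ℝ) : Continuous (steinOperator α β i p) := by
  have (q : MvPolynomial (Fin d) ℝ) : Continuous fun x => q.eval x := q.continuous_eval
  unfold steinOperator
  fun_prop

theorem steinOperator_add (α : Fin d → ℝ) (β : ℝ) (i : Fin d) (p q : MvPolynomial (Fin d) ℝ) :
    steinOperator α β i (p + q) = steinOperator α β i p + steinOperator α β i q := by
  funext x
  simp only [steinOperator, Pi.add_apply, map_add, mul_add, Finset.sum_add_distrib]
  ring

theorem steinOperator_mul_X (hα : ∀ i, 0 < α i) (β : ℝ) (i j : Fin d)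
    (p : MvPolynomial (Fin d) ℝ) (x : Fin d → ℝ) :
    steinOperator α β i (p * .X j) x =
      x j * steinOperator (Function.update α j (α j + 1)) β i p x := by
  have hderiv (k : Fin d) : ((p * .X j).pderiv k).eval x =
      (p.pderiv k).eval x * x j + p.eval x * if k = j then 1 else 0 := by
    rcases eq_or_ne k j with rfl | hkj
    · simp [add_comm, mul_comm]
    · simp [MvPolynomial.pderiv_X_of_ne hkj.symm, hkj, mul_comm]
  have hsum : ∑ k, x k * ((p * .X j).pderiv k).eval x =
      x j * ∑ k, x k * (p.pderiv k).eval x + x j * p.eval x := by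
    simp only [hderiv, mul_add, Finset.sum_add_distrib, Finset.mul_sum, mul_comm, mul_left_comm]
    simp
  have hα' : Function.update α j (α j + 1) i = α i + if i = j then 1 else 0 := by
    rcases eq_or_ne i j with rfl | hij
    · simp
    · simp [hij]
  have hcoord : x i * (if i = j then 1 else 0) = x j * if i = j then 1 else 0 := by
    rcases eq_or_ne i j with rfl | hij
    · rfl
    · simp [hij]
  simp only [steinOperator, hderiv i, hsum, hα', l1_update_add_one (hα j).le, map_mul,
    MvPolynomial.eval_X]
  linear_combination -p.eval x * hcoord

theorem integral_steinOperator (hα : ∀ i, 0 < α i) (hβ : 0 < β) (i : Fin d)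
    (p : MvPolynomial (Fin d) ℝ) : ∫ x, steinOperator α β i p x ∂(dirichletMeasure α β) = 0 := by
  induction p using MvPolynomial.induction_on generalizing α with
  | C a =>
    have := isProbabilityMeasure_dirichletMeasure hα hβ
    have hmean := integral_coord_dirichletMeasure hα hβ i
    have hsum : l1 α + β ≠ 0 := (add_pos_of_nonneg_of_pos (l1_nonneg α) hβ).ne'
    simp only [steinOperator, MvPolynomial.eval_C, MvPolynomial.pderiv_C, map_zero, mul_zero,
      Finset.sum_const_zero, sub_zero, integral_mul_const]
    rw [integral_sub (integrable_dirichletMeasure hα hβ (by fun_prop)) (integrable_const _),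
      integral_const_mul, hmean]
    simp [mul_div_cancel₀ _ hsum]
  | add p q hp hq =>
    simp only [steinOperator_add, Pi.add_apply]
    rw [integral_add, hp hα, hq hα, add_zero] <;>
      exact integrable_dirichletMeasure hα hβ (continuous_steinOperator _ _ _ _).continuousOn
  | mul_X p j hp =>
    simp only [steinOperator_mul_X hα]
    rw [integral_coord_mul_dirichletMeasure hα hβ, hp (update_add_one_pos hα j), mul_zero]

end Dirichlet

/-! ### The kernel of the estimator -/

/-- The Dirichlet distribution whose density is the kernel of the estimator at `s`. Integrating
against it is taking the expectation of the estimator. -/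
noncomputable def kernelMeasure (s : Fin d → ℝ) (b : ℝ) : Measure (Fin d → ℝ) :=
  dirichletMeasure (fun i => s i / b + 1) ((1 - l1 s) / b + 1)

theorem ae_kernelMeasure_mem_simplex (s : Fin d → ℝ) (b : ℝ) :
    ∀ᵐ x ∂(kernelMeasure s b), x ∈ simplex d :=
  ae_densityMeasure_mem_simplex _

section Kernel

variable {s : Fin d → ℝ} {b : ℝ}

theorem coord_div_add_one_pos (hs : s ∈ simplex d) (hb : 0 < b) (i : Fin d) : 0 < s i / b + 1 :=
  add_pos_of_nonneg_of_pos (div_nonneg (coord_nonneg_of_mem_simplex hs i) hb.le) one_pos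

theorem one_sub_l1_div_add_one_pos (hs : s ∈ simplex d) (hb : 0 < b) : 0 < (1 - l1 s) / b + 1 :=
  add_pos_of_nonneg_of_pos (div_nonneg (one_sub_l1_nonneg hs) hb.le) one_pos

theorem l1_div_add_one_add (hs : s ∈ simplex d) (hb : 0 < b) :
    l1 (fun i => s i / b + 1) + ((1 - l1 s) / b + 1) = 1 / b + (d + 1) := by
  rw [l1_eq_sum fun i => (coord_div_add_one_pos hs hb i).le, Finset.sum_add_distrib,
    ← Finset.sum_div, ← l1_eq_sum_of_mem_simplex hs]
  simp only [Finset.sum_const, Finset.card_univ, Fintype.card_fin, nsmul_eq_mul, mul_one]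
  ring

theorem isProbabilityMeasure_kernelMeasure (hs : s ∈ simplex d) (hb : 0 < b) :
    IsProbabilityMeasure (kernelMeasure s b) :=
  isProbabilityMeasure_dirichletMeasure (coord_div_add_one_pos hs hb)
    (one_sub_l1_div_add_one_pos hs hb)

theorem integrable_kernelMeasure (hs : s ∈ simplex d) (hb : 0 < b) {h : (Fin d → ℝ) → ℝ}
    (hh : ContinuousOn h (simplex d)) : Integrable h (kernelMeasure s b) :=
  integrable_dirichletMeasure (coord_div_add_one_pos hs hb) (one_sub_l1_div_add_one_pos hs hb) hh

theorem integral_kernelMeasure_mono (hs : s ∈ simplex d) (hb : 0 < b) {h k : (Fin d → ℝ) → ℝ}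
    (hh : ContinuousOn h (simplex d)) (hk : ContinuousOn k (simplex d))
    (hle : ∀ x ∈ simplex d, h x ≤ k x) :
    ∫ x, h x ∂(kernelMeasure s b) ≤ ∫ x, k x ∂(kernelMeasure s b) :=
  integral_mono_ae (integrable_kernelMeasure hs hb hh) (integrable_kernelMeasure hs hb hk)
    ((ae_kernelMeasure_mem_simplex s b).mono hle)

theorem abs_integral_kernelMeasure_le (hs : s ∈ simplex d) (hb : 0 < b) {h k : (Fin d → ℝ) → ℝ}
    (hk : ContinuousOn k (simplex d)) (hle : ∀ x ∈ simplex d, |h x| ≤ k x) :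
    |∫ x, h x ∂(kernelMeasure s b)| ≤ ∫ x, k x ∂(kernelMeasure s b) := by
  rw [← Real.norm_eq_abs]
  exact norm_integral_le_of_norm_le (integrable_kernelMeasure hs hb hk)
    ((ae_kernelMeasure_mem_simplex s b).mono hle)

theorem integral_sub_mul_eval_kernelMeasure (hs : s ∈ simplex d) (hb : 0 < b) (i : Fin d)
    (p : MvPolynomial (Fin d) ℝ) :
    ∫ x, (x i - s i) * p.eval x ∂(kernelMeasure s b) =
      b * ∫ x, (x i * ((p.pderiv i).eval x - ∑ j, x j * (p.pderiv j).eval x) +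
        (1 - (d + 1) * x i) * p.eval x) ∂(kernelMeasure s b) := by
  have hp (q : MvPolynomial (Fin d) ℝ) : Continuous fun x => q.eval x := q.continuous_eval
  have hstein := integral_steinOperator (coord_div_add_one_pos hs hb)
    (one_sub_l1_div_add_one_pos hs hb) i p
  have hcont := continuous_steinOperator (fun i => s i / b + 1) ((1 - l1 s) / b + 1) i p
  have hsplit (x : Fin d → ℝ) : (x i - s i) * p.eval x =
      b * (steinOperator (fun i => s i / b + 1) ((1 - l1 s) / b + 1) i p x +
        (x i * ((p.pderiv i).eval x - ∑ j, x j * (p.pderiv j).eval x) +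
          (1 - (d + 1) * x i) * p.eval x)) := by
    rw [steinOperator, l1_div_add_one_add hs hb]
    field_simp
    ring
  simp_rw [hsplit]
  rw [integral_const_mul, integral_add (integrable_kernelMeasure hs hb hcont.continuousOn)
    (integrable_kernelMeasure hs hb (Continuous.continuousOn (by fun_prop))), kernelMeasure,
    hstein, zero_add]

theorem integral_sub_kernelMeasure (hs : s ∈ simplex d) (hb : 0 < b) (i : Fin d) :
    ∫ x, (x i - s i) ∂(kernelMeasure s b) = b * ∫ x, (1 - (d + 1) * x i) ∂(kernelMeasure s b) := by
  simpa using integral_sub_mul_eval_kernelMeasure hs hb i 1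

theorem integral_sub_mul_sub_kernelMeasure (hs : s ∈ simplex d) (hb : 0 < b) (i j : Fin d) :
    ∫ x, (x i - s i) * (x j - s j) ∂(kernelMeasure s b) =
      b * ∫ x, (x i * ((if i = j then 1 else 0) - x j) + (1 - (d + 1) * x i) * (x j - s j))
        ∂(kernelMeasure s b) := by
  have hderiv (k : Fin d) (x : Fin d → ℝ) :
      ((.X j - .C (s j) : MvPolynomial (Fin d) ℝ).pderiv k).eval x = if k = j then 1 else 0 := by
    rcases eq_or_ne k j with rfl | hkj
    · simp
    · simp [hkj]
  have h := integral_sub_mul_eval_kernelMeasure hs hb i (.X j - .C (s j))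
  simp only [hderiv] at h
  simpa using h

theorem integral_sub_pow_add_two_kernelMeasure (hs : s ∈ simplex d) (hb : 0 < b) (i : Fin d)
    (k : ℕ) :
    ∫ x, (x i - s i) ^ (k + 2) ∂(kernelMeasure s b) =
      b * ∫ x, ((k + 1) * (x i * (1 - x i)) + (1 - (d + 1) * x i) * (x i - s i)) *
        (x i - s i) ^ k ∂(kernelMeasure s b) := by
  have hderiv (j : Fin d) (x : Fin d → ℝ) :
      (((.X i - .C (s i) : MvPolynomial (Fin d) ℝ) ^ (k + 1)).pderiv j).eval x =
        if j = i then (k + 1) * (x i - s i) ^ k else 0 := by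
    rcases eq_or_ne j i with rfl | hji
    · simp
    · simp [MvPolynomial.pderiv_X_of_ne hji.symm, hji]
  have h := integral_sub_mul_eval_kernelMeasure hs hb i ((.X i - .C (s i)) ^ (k + 1))
  simp only [hderiv, mul_ite, mul_zero, Finset.sum_ite_eq', Finset.mem_univ, if_true, map_pow,
    map_sub, MvPolynomial.eval_X, MvPolynomial.eval_C, ← pow_succ'] at h
  rw [h]
  congr 1
  refine integral_congr_ae (.of_forall fun x => ?_)
  ring

theorem integral_sub_pow_add_two_kernelMeasure_le (hs : s ∈ simplex d) (hb : 0 < b) (i : Fin d)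
    {k : ℕ} (hk : Even k) :
    ∫ x, (x i - s i) ^ (k + 2) ∂(kernelMeasure s b) ≤
      b * ((k + d + 2) * ∫ x, (x i - s i) ^ k ∂(kernelMeasure s b)) := by
  rw [integral_sub_pow_add_two_kernelMeasure hs hb]
  refine mul_le_mul_of_nonneg_left ?_ hb.le
  rw [← integral_const_mul]
  refine integral_kernelMeasure_mono hs hb (Continuous.continuousOn (by fun_prop))
    (Continuous.continuousOn (by fun_prop)) fun x hx => ?_
  obtain ⟨hx0, hx1⟩ := hx.1 i
  obtain ⟨hs0, hs1⟩ := hs.1 i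
  have hvar : x i * (1 - x i) ≤ 1 := by nlinarith
  have hdrift : (1 - (d + 1) * x i) * (x i - s i) ≤ d + 1 := by
    have h1 : |1 - (d + 1) * x i| ≤ d + 1 := abs_le.2 ⟨by nlinarith, by nlinarith⟩
    have h2 : |x i - s i| ≤ 1 := abs_le.2 ⟨by linarith, by linarith⟩
    refine (le_abs_self _).trans ?_
    rw [abs_mul]
    nlinarith [abs_nonneg (x i - s i)]
  have hvar_mul : (k + 1) * (x i * (1 - x i)) ≤ (k + 1) * 1 := by gcongr
  refine mul_le_mul_of_nonneg_right ?_ (hk.pow_nonneg _)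
  linarith

theorem exists_integral_sub_pow_kernelMeasure_le (d m : ℕ) :
    ∃ C, 0 ≤ C ∧ ∀ s ∈ simplex d, ∀ b > 0, ∀ i,
      ∫ x, (x i - s i) ^ (2 * m) ∂(kernelMeasure s b) ≤ C * b ^ m := by
  induction m with
  | zero =>
    refine ⟨1, zero_le_one, fun s hs b hb i => ?_⟩
    have := isProbabilityMeasure_kernelMeasure hs hb
    simp
  | succ m ih =>
    obtain ⟨C, hC0, hC⟩ := ih
    refine ⟨(↑(2 * m) + d + 2) * C, by positivity, fun s hs b hb i => ?_⟩
    calc ∫ x, (x i - s i) ^ (2 * m + 2) ∂(kernelMeasure s b)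
        ≤ b * ((↑(2 * m) + d + 2) * (C * b ^ m)) := by
          refine (integral_sub_pow_add_two_kernelMeasure_le hs hb i (even_two_mul m)).trans ?_
          gcongr
          exact hC s hs b hb i
      _ = (↑(2 * m) + d + 2) * C * b ^ (m + 1) := by ring

theorem norm_pow_le_sum_abs_pow {k : ℕ} (hk : k ≠ 0) (v : Fin d → ℝ) :
    ‖v‖ ^ k ≤ ∑ i, |v i| ^ k := by
  rcases isEmpty_or_nonempty (Fin d) with hd | hd
  · simp [Subsingleton.elim v 0, hk]
  · obtain ⟨i, -, hi⟩ :=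
      Finset.exists_mem_eq_sup Finset.univ Finset.univ_nonempty fun i => ‖v i‖₊
    have hnorm : ‖v‖ = |v i| := by
      rw [Pi.norm_def, hi]
      rfl
    rw [hnorm]
    exact Finset.single_le_sum (f := fun i => |v i| ^ k) (fun i _ => by positivity)
      (Finset.mem_univ i)

theorem exists_integral_norm_sub_pow_kernelMeasure_le (d m : ℕ) :
    ∃ C, 0 ≤ C ∧ ∀ s ∈ simplex d, ∀ b > 0,
      ∫ x, ‖x - s‖ ^ (2 * m) ∂(kernelMeasure s b) ≤ C * b ^ m := by
  rcases eq_or_ne m 0 with rfl | hm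
  · refine ⟨1, zero_le_one, fun s hs b hb => ?_⟩
    have := isProbabilityMeasure_kernelMeasure hs hb
    simp
  obtain ⟨C, hC0, hC⟩ := exists_integral_sub_pow_kernelMeasure_le d m
  refine ⟨d * C, by positivity, fun s hs b hb => ?_⟩
  calc ∫ x, ‖x - s‖ ^ (2 * m) ∂(kernelMeasure s b)
      ≤ ∫ x, ∑ i, (x i - s i) ^ (2 * m) ∂(kernelMeasure s b) := by
        refine integral_kernelMeasure_mono hs hb (Continuous.continuousOn (by fun_prop))
          (Continuous.continuousOn (by fun_prop)) fun x _ => ?_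
        simpa [(even_two_mul m).pow_abs] using
          norm_pow_le_sum_abs_pow (mul_ne_zero two_ne_zero hm) (x - s)
    _ = ∑ i, ∫ x, (x i - s i) ^ (2 * m) ∂(kernelMeasure s b) :=
        integral_finsetSum _ fun i _ =>
          integrable_kernelMeasure hs hb (Continuous.continuousOn (by fun_prop))
    _ ≤ ∑ _i : Fin d, C * b ^ m := Finset.sum_le_sum fun i _ => hC s hs b hb i
    _ = d * C * b ^ m := by simp [mul_assoc]

theorem exists_abs_le_norm_pow_add_of_isLittleO {R : (Fin d → ℝ) → ℝ}
    (hR : ContinuousOn R (simplex d)) (k l : ℕ)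
    (hRs : R =o[𝓝[simplex d] s] fun x => ‖x - s‖ ^ k) {ε : ℝ} (hε : 0 < ε) :
    ∃ C, 0 ≤ C ∧ ∀ x ∈ simplex d, |R x| ≤ ε * ‖x - s‖ ^ k + C * ‖x - s‖ ^ l := by
  obtain ⟨M, hM0, hM⟩ := exists_abs_le_of_continuousOn_simplex hR
  obtain ⟨δ, hδ, hnear⟩ := Metric.mem_nhdsWithin_iff.1 (hRs.def hε)
  refine ⟨M / δ ^ l, by positivity, fun x hx => ?_⟩
  rcases lt_or_ge ‖x - s‖ δ with hxs | hxs
  · have h := hnear ⟨mem_ball_iff_norm.2 hxs, hx⟩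
    simp only [Set.mem_ofPred_eq, Real.norm_eq_abs, abs_pow, abs_norm] at h
    exact h.trans (le_add_of_nonneg_right (by positivity))
  · have hfar : 1 ≤ ‖x - s‖ ^ l / δ ^ l := (one_le_div (by positivity)).2 (by gcongr)
    calc |R x| ≤ M * (‖x - s‖ ^ l / δ ^ l) := (hM x hx).trans (le_mul_of_one_le_right hM0 hfar)
      _ = M / δ ^ l * ‖x - s‖ ^ l := by ring
      _ ≤ ε * ‖x - s‖ ^ k + M / δ ^ l * ‖x - s‖ ^ l := le_add_of_nonneg_left (by positivity)

theorem isLittleO_integral_kernelMeasure (hs : s ∈ simplex d) {R : (Fin d → ℝ) → ℝ}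
    (hR : ContinuousOn R (simplex d)) (m : ℕ)
    (hRs : R =o[𝓝[simplex d] s] fun x => ‖x - s‖ ^ (2 * m)) :
    (fun b => ∫ x, R x ∂(kernelMeasure s b)) =o[𝓝[>] 0] fun b => b ^ m := by
  obtain ⟨C₁, hC₁0, hC₁⟩ := exists_integral_norm_sub_pow_kernelMeasure_le d m
  obtain ⟨C₂, hC₂0, hC₂⟩ := exists_integral_norm_sub_pow_kernelMeasure_le d (m + 1)
  refine isLittleO_iff.2 fun c hc => ?_
  set ε := c / (2 * (C₁ + 1)) with hε
  obtain ⟨C, hC0, hC⟩ := exists_abs_le_norm_pow_add_of_isLittleO hR (2 * m) (2 * (m + 1)) hRs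
    (by positivity : 0 < ε)
  have hsmall : ∀ᶠ b in 𝓝[>] (0 : ℝ), b < c / (2 * (C * C₂ + 1)) :=
    nhdsWithin_le_nhds (eventually_lt_nhds (by positivity))
  filter_upwards [hsmall, self_mem_nhdsWithin] with b hbc hb
  have hb : 0 < b := hb
  have hnear : ε * C₁ ≤ c / 2 := by
    rw [hε, div_mul_eq_mul_div, div_le_div_iff₀ (by positivity) two_pos]
    nlinarith
  have hfar : C * C₂ * b ≤ c / 2 := by
    rw [lt_div_iff₀ (by positivity)] at hbc
    nlinarith
  rw [Real.norm_eq_abs, Real.norm_of_nonneg (by positivity)]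
  calc |∫ x, R x ∂(kernelMeasure s b)|
      ≤ ∫ x, (ε * ‖x - s‖ ^ (2 * m) + C * ‖x - s‖ ^ (2 * (m + 1))) ∂(kernelMeasure s b) :=
        abs_integral_kernelMeasure_le hs hb (Continuous.continuousOn (by fun_prop)) hC
    _ = ε * ∫ x, ‖x - s‖ ^ (2 * m) ∂(kernelMeasure s b) +
          C * ∫ x, ‖x - s‖ ^ (2 * (m + 1)) ∂(kernelMeasure s b) := by
        rw [integral_add, integral_const_mul, integral_const_mul] <;>
          exact integrable_kernelMeasure hs hb (Continuous.continuousOn (by fun_prop))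
    _ ≤ ε * (C₁ * b ^ m) + C * (C₂ * b ^ (m + 1)) := by
        gcongr
        exacts [hC₁ s hs b hb, hC₂ s hs b hb]
    _ = (ε * C₁ + C * C₂ * b) * b ^ m := by ring
    _ ≤ c * b ^ m := by
        gcongr
        linarith

theorem tendsto_integral_kernelMeasure (hs : s ∈ simplex d) {h : (Fin d → ℝ) → ℝ}
    (hh : ContinuousOn h (simplex d)) :
    Tendsto (fun b => ∫ x, h x ∂(kernelMeasure s b)) (𝓝[>] 0) (𝓝 (h s)) := by
  have hsub : (fun x => h x - h s) =o[𝓝[simplex d] s] fun x => ‖x - s‖ ^ (2 * 0) := by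
    simpa [isLittleO_one_iff] using tendsto_sub_nhds_zero_iff.2 (hh s hs)
  have hlim := isLittleO_integral_kernelMeasure hs (hh.sub continuousOn_const) 0 hsub
  simp only [pow_zero, isLittleO_one_iff] at hlim
  rw [← tendsto_sub_nhds_zero_iff]
  refine hlim.congr' (eventually_mem_nhdsWithin.mono fun b hb => ?_)
  have := isProbabilityMeasure_kernelMeasure hs hb
  simp [integral_sub (integrable_kernelMeasure hs hb hh) (integrable_const (h s))]

theorem tendsto_integral_sub_kernelMeasure_div (hs : s ∈ simplex d) (i : Fin d) :
    Tendsto (fun b => (∫ x, (x i - s i) ∂(kernelMeasure s b)) / b) (𝓝[>] 0)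
      (𝓝 (1 - (d + 1) * s i)) := by
  have hcont : Continuous fun x : Fin d → ℝ => 1 - (d + 1) * x i := by fun_prop
  refine (tendsto_integral_kernelMeasure hs hcont.continuousOn).congr'
    (eventually_mem_nhdsWithin.mono fun b hb => ?_)
  simp only [integral_sub_kernelMeasure hs hb, mul_div_cancel_left₀ _ (Set.mem_Ioi.1 hb).ne']

theorem tendsto_integral_sub_mul_sub_kernelMeasure_div (hs : s ∈ simplex d) (i j : Fin d) :
    Tendsto (fun b => (∫ x, (x i - s i) * (x j - s j) ∂(kernelMeasure s b)) / b) (𝓝[>] 0)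
      (𝓝 (s i * ((if i = j then 1 else 0) - s j))) := by
  have hcont : Continuous fun x : Fin d → ℝ =>
      x i * ((if i = j then 1 else 0) - x j) + (1 - (d + 1) * x i) * (x j - s j) := by fun_prop
  have hlim := tendsto_integral_kernelMeasure hs hcont.continuousOn
  simp only [sub_self, mul_zero, add_zero] at hlim
  refine hlim.congr' (eventually_mem_nhdsWithin.mono fun b hb => ?_)
  simp only [integral_sub_mul_sub_kernelMeasure hs hb,
    mul_div_cancel_left₀ _ (Set.mem_Ioi.1 hb).ne']

end Kernel

/-! ### Taylor estimates on a convex set -/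

section Taylor

variable {E F : Type*} [NormedAddCommGroup E] [NormedSpace ℝ E] [NormedAddCommGroup F]
  [NormedSpace ℝ F] {S : Set E} {f : E → F} {f' : E → E →L[ℝ] F} {s z : E}

theorem hasDerivWithinAt_comp_add_smul_sub (hS : Convex ℝ S)
    (hf : ∀ x ∈ S, HasFDerivWithinAt f (f' x) S x) (hs : s ∈ S) (hz : z ∈ S) {t : ℝ}
    (ht : t ∈ Set.Icc (0 : ℝ) 1) :
    HasDerivWithinAt (fun t : ℝ => f (s + t • (z - s))) (f' (s + t • (z - s)) (z - s))
      (Set.Icc 0 1) t := by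
  have hline : HasDerivWithinAt (fun t : ℝ => s + t • (z - s)) (z - s) (Set.Icc 0 1) t := by
    simpa using (((hasDerivAt_id t).smul_const (z - s)).const_add s).hasDerivWithinAt
  exact (hf _ (hS.add_smul_sub_mem hs hz ht)).comp_hasDerivWithinAt t hline
    fun u hu => hS.add_smul_sub_mem hs hz hu

theorem norm_sub_taylor_two_le_of_norm_fderiv_sub_le (hS : Convex ℝ S)
    (hf : ∀ x ∈ S, HasFDerivWithinAt f (f' x) S x) (hs : s ∈ S) (hz : z ∈ S) {q : F} {C : ℝ}
    (hC : ∀ t ∈ Set.Icc (0 : ℝ) 1,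
      ‖f' (s + t • (z - s)) (z - s) - f' s (z - s) - t • q‖ ≤ C) :
    ‖f z - f s - f' s (z - s) - (1 / 2 : ℝ) • q‖ ≤ C := by
  have hderiv : ∀ t ∈ Set.Icc (0 : ℝ) 1, HasDerivWithinAt
      (fun t : ℝ => f (s + t • (z - s)) - t • f' s (z - s) - (t ^ 2 / 2) • q)
      (f' (s + t • (z - s)) (z - s) - f' s (z - s) - t • q) (Set.Icc 0 1) t := fun t ht => by
    have hlin : HasDerivWithinAt (fun t : ℝ => t • f' s (z - s)) (f' s (z - s))
        (Set.Icc 0 1) t := by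
      simpa using ((hasDerivAt_id t).smul_const (f' s (z - s))).hasDerivWithinAt
    have hquad : HasDerivWithinAt (fun t : ℝ => (t ^ 2 / 2) • q) (t • q) (Set.Icc 0 1) t := by
      simpa using (((hasDerivAt_pow 2 t).div_const 2).smul_const q).hasDerivWithinAt
    exact ((hasDerivWithinAt_comp_add_smul_sub hS hf hs hz ht).sub hlin).sub hquad
  have h := norm_image_sub_le_of_norm_deriv_le_segment_01' hderiv
    fun t ht => hC t ⟨ht.1, ht.2.le⟩
  convert h using 2
  simp
  abel

theorem norm_sub_taylor_one_le_of_lipschitz (hS : Convex ℝ S)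
    (hf : ∀ x ∈ S, HasFDerivWithinAt f (f' x) S x) {L : ℝ} (hL0 : 0 ≤ L)
    (hL : ∀ x ∈ S, ∀ y ∈ S, ‖f' x - f' y‖ ≤ L * ‖x - y‖) (hs : s ∈ S) (hz : z ∈ S) :
    ‖f z - f s - f' s (z - s)‖ ≤ L * ‖z - s‖ ^ 2 := by
  have h := norm_sub_taylor_two_le_of_norm_fderiv_sub_le hS hf hs hz (q := 0)
    (C := L * ‖z - s‖ ^ 2) fun t ht => by
    have hLt := hL _ (hS.add_smul_sub_mem hs hz ht) s hs
    rw [add_sub_cancel_left, norm_smul, Real.norm_of_nonneg ht.1] at hLt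
    rw [smul_zero, sub_zero, ← sub_apply]
    calc ‖(f' (s + t • (z - s)) - f' s) (z - s)‖
        ≤ ‖f' (s + t • (z - s)) - f' s‖ * ‖z - s‖ := ContinuousLinearMap.le_opNorm _ _
      _ ≤ (L * (1 * ‖z - s‖)) * ‖z - s‖ := by
        gcongr
        refine hLt.trans ?_
        gcongr
        exact ht.2
      _ = L * ‖z - s‖ ^ 2 := by ring
  simpa using h

theorem isLittleO_sub_taylor_two (hS : Convex ℝ S)
    (hf : ∀ x ∈ S, HasFDerivWithinAt f (f' x) S x) (hs : s ∈ S) {f'' : E →L[ℝ] E →L[ℝ] F}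
    (hf' : HasFDerivWithinAt f' f'' S s) :
    (fun z => f z - f s - f' s (z - s) - (1 / 2 : ℝ) • f'' (z - s) (z - s)) =o[𝓝[S] s]
      fun z => ‖z - s‖ ^ 2 := by
  refine isLittleO_iff.2 fun ε hε => ?_
  obtain ⟨δ, hδ, hnear⟩ := Metric.mem_nhdsWithin_iff.1 (hf'.isLittleO.def hε)
  refine Metric.mem_nhdsWithin_iff.2 ⟨δ, hδ, fun z ⟨hzs, hz⟩ => ?_⟩
  rw [Set.mem_ofPred_eq, norm_pow, norm_norm]
  refine norm_sub_taylor_two_le_of_norm_fderiv_sub_le hS hf hs hz fun t ht => ?_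
  have hle : ‖t • (z - s)‖ ≤ ‖z - s‖ := by
    rw [norm_smul, Real.norm_of_nonneg ht.1]
    exact mul_le_of_le_one_left (norm_nonneg _) ht.2
  have hball : s + t • (z - s) ∈ Metric.ball s δ := by
    rw [mem_ball_iff_norm, add_sub_cancel_left]
    exact hle.trans_lt (mem_ball_iff_norm.1 hzs)
  have hε := hnear ⟨hball, hS.add_smul_sub_mem hs hz ht⟩
  rw [Set.mem_ofPred_eq, add_sub_cancel_left] at hε
  calc ‖f' (s + t • (z - s)) (z - s) - f' s (z - s) - t • f'' (z - s) (z - s)‖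
      = ‖(f' (s + t • (z - s)) - f' s - f'' (t • (z - s))) (z - s)‖ := by simp
    _ ≤ ‖f' (s + t • (z - s)) - f' s - f'' (t • (z - s))‖ * ‖z - s‖ :=
        ContinuousLinearMap.le_opNorm _ _
    _ ≤ (ε * ‖z - s‖) * ‖z - s‖ := by
        gcongr
        exact hε.trans (by gcongr)
    _ = ε * ‖z - s‖ ^ 2 := by ring

end Taylor

/-! ### Derivatives on the simplex -/

theorem nonempty_interior_simplex : (interior (simplex d)).Nonempty := by
  have hopen : IsOpen {s : Fin d → ℝ | (∀ i, 0 < s i) ∧ ∑ i, s i < 1} := by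
    simp only [Set.ofPred_and, Set.ofPred_forall]
    exact (isOpen_iInter_of_finite fun i => isOpen_lt continuous_const (continuous_apply i)).inter
      (isOpen_lt (by fun_prop) continuous_const)
  refine ⟨fun _ => 1 / ((d : ℝ) + 1), interior_maximal ?_ hopen ⟨fun _ => by positivity, ?_⟩⟩
  · rw [simplex_eq_scaledSimplex]
    exact fun s hs => ⟨fun i => (hs.1 i).le, hs.2.le⟩
  · simp only [Finset.sum_const, Finset.card_univ, Fintype.card_fin, nsmul_eq_mul]
    rw [mul_one_div, div_lt_one (by positivity)]
    linarith

theorem uniqueDiffOn_simplex : UniqueDiffOn ℝ (simplex d) :=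
  uniqueDiffOn_convex convex_simplex nonempty_interior_simplex

theorem fderivWithin_apply_eq_sum_pderiv (f : (Fin d → ℝ) → ℝ) (s v : Fin d → ℝ) :
    fderivWithin ℝ f (simplex d) s v = ∑ i, v i * pderiv i f s := by
  conv_lhs => rw [pi_eq_sum_univ' v]
  simp [pderiv, map_sum]

section ContDiff

variable {f : (Fin d → ℝ) → ℝ} (hf : ContDiffOn ℝ 2 f (simplex d))

include hf

theorem contDiffOn_fderivWithin_simplex :
    ContDiffOn ℝ 1 (fderivWithin ℝ f (simplex d)) (simplex d) :=
  hf.fderivWithin uniqueDiffOn_simplex (by norm_num)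

theorem hasFDerivWithinAt_simplex : ∀ x ∈ simplex d,
    HasFDerivWithinAt f (fderivWithin ℝ f (simplex d) x) (simplex d) x :=
  fun x hx => (hf.differentiableOn (by norm_num) x hx).hasFDerivWithinAt

theorem hasFDerivWithinAt_fderivWithin_simplex : ∀ x ∈ simplex d,
    HasFDerivWithinAt (fderivWithin ℝ f (simplex d))
      (fderivWithin ℝ (fderivWithin ℝ f (simplex d)) (simplex d) x) (simplex d) x :=
  fun x hx => ((contDiffOn_fderivWithin_simplex hf).differentiableOn one_ne_zero x hx)
    |>.hasFDerivWithinAt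

theorem contDiffOn_pderiv (i : Fin d) : ContDiffOn ℝ 1 (pderiv i f) (simplex d) :=
  (contDiffOn_fderivWithin_simplex hf).clm_apply contDiffOn_const

theorem continuousOn_pderiv_pderiv (i j : Fin d) :
    ContinuousOn (pderiv i (pderiv j f)) (simplex d) :=
  ((contDiffOn_pderiv hf j).continuousOn_fderivWithin uniqueDiffOn_simplex le_rfl).clm_apply
    continuousOn_const

theorem continuousOn_biasCoeff : ContinuousOn (biasCoeff f) (simplex d) := by
  have hfirst (i : Fin d) := (contDiffOn_pderiv hf i).continuousOn
  have hsecond (i j : Fin d) := continuousOn_pderiv_pderiv hf i j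
  unfold biasCoeff
  fun_prop

theorem pderiv_pderiv_eq_fderivWithin_fderivWithin {s : Fin d → ℝ} (hs : s ∈ simplex d)
    (i j : Fin d) : pderiv i (pderiv j f) s =
      fderivWithin ℝ (fderivWithin ℝ f (simplex d)) (simplex d) s (Pi.single i 1)
        (Pi.single j 1) := by
  have h := (hasFDerivWithinAt_fderivWithin_simplex hf s hs).clm_apply
    (hasFDerivWithinAt_const (Pi.single j (1 : ℝ)) s (simplex d))
  unfold pderiv
  rw [h.fderivWithin (uniqueDiffOn_simplex s hs)]
  simp

theorem fderivWithin_fderivWithin_apply_eq_sum_pderiv {s : Fin d → ℝ} (hs : s ∈ simplex d)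
    (v : Fin d → ℝ) :
    fderivWithin ℝ (fderivWithin ℝ f (simplex d)) (simplex d) s v v =
      ∑ i, ∑ j, v i * v j * pderiv i (pderiv j f) s := by
  simp_rw [pderiv_pderiv_eq_fderivWithin_fderivWithin hf hs]
  conv_lhs => rw [pi_eq_sum_univ' v]
  simp only [map_sum, map_smul, sum_apply, smul_apply, smul_eq_mul, Finset.mul_sum]
  rw [Finset.sum_comm]
  simp only [mul_assoc, mul_left_comm]

theorem exists_lipschitz_fderivWithin_simplex :
    ∃ L, 0 ≤ L ∧ ∀ x ∈ simplex d, ∀ y ∈ simplex d,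
      ‖fderivWithin ℝ f (simplex d) x - fderivWithin ℝ f (simplex d) y‖ ≤ L * ‖x - y‖ := by
  obtain ⟨L, hL⟩ := isCompact_simplex.exists_bound_of_continuousOn
    ((contDiffOn_fderivWithin_simplex hf).continuousOn_fderivWithin uniqueDiffOn_simplex le_rfl)
  exact ⟨max L 0, le_max_right _ _, fun x hx y hy =>
    convex_simplex.norm_image_sub_le_of_norm_hasFDerivWithin_le
      (hasFDerivWithinAt_fderivWithin_simplex hf)
      (fun z hz => (hL z hz).trans (le_max_left _ _)) hy hx⟩

end ContDiff

/-! ### The pointwise bias -/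

section Bias

variable {f : (Fin d → ℝ) → ℝ} {s : Fin d → ℝ}

theorem abs_integral_sub_kernelMeasure_le (hs : s ∈ simplex d) {b : ℝ} (hb : 0 < b)
    (i : Fin d) : |∫ x, (x i - s i) ∂(kernelMeasure s b)| ≤ (d + 1) * b := by
  have := isProbabilityMeasure_kernelMeasure hs hb
  have hdrift : |∫ x, (1 - (d + 1) * x i) ∂(kernelMeasure s b)| ≤ d + 1 := by
    refine (abs_integral_kernelMeasure_le hs hb (k := fun _ => (d : ℝ) + 1) continuousOn_const
      fun x hx => ?_).trans (by simp)
    obtain ⟨hx0, hx1⟩ := hx.1 i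
    exact abs_le.2 ⟨by nlinarith, by nlinarith⟩
  rw [integral_sub_kernelMeasure hs hb, abs_mul, abs_of_pos hb, mul_comm]
  gcongr

theorem integral_sub_sub_kernelMeasure (hs : s ∈ simplex d) {b : ℝ} (hb : 0 < b)
    (hf : ContinuousOn f (simplex d)) {T : (Fin d → ℝ) → ℝ} (hT : Continuous T) :
    ∫ x, (f x - f s - T x) ∂(kernelMeasure s b) =
      ∫ x, f x ∂(kernelMeasure s b) - f s - ∫ x, T x ∂(kernelMeasure s b) := by
  have := isProbabilityMeasure_kernelMeasure hs hb
  have hfint := integrable_kernelMeasure hs hb hf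
  have hTint := integrable_kernelMeasure hs hb hT.continuousOn
  have hsub : Integrable (fun x => f x - f s) (kernelMeasure s b) := hfint.sub (integrable_const _)
  rw [integral_sub hsub hTint, integral_sub hfint (integrable_const _)]
  simp

theorem integral_sum_sub_mul_kernelMeasure (hs : s ∈ simplex d) {b : ℝ} (hb : 0 < b)
    (c : Fin d → ℝ) :
    ∫ x, ∑ i, (x i - s i) * c i ∂(kernelMeasure s b) =
      ∑ i, (∫ x, (x i - s i) ∂(kernelMeasure s b)) * c i := by
  rw [integral_finsetSum _ fun i _ =>
    integrable_kernelMeasure hs hb (Continuous.continuousOn (by fun_prop))]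
  simp_rw [integral_mul_const]

theorem integral_sum_sum_sub_mul_sub_mul_kernelMeasure (hs : s ∈ simplex d) {b : ℝ} (hb : 0 < b)
    (c : Fin d → Fin d → ℝ) :
    ∫ x, ∑ i, ∑ j, (x i - s i) * (x j - s j) * c i j ∂(kernelMeasure s b) =
      ∑ i, ∑ j, (∫ x, (x i - s i) * (x j - s j) ∂(kernelMeasure s b)) * c i j := by
  have hint {h : (Fin d → ℝ) → ℝ} (hh : Continuous h) : Integrable h (kernelMeasure s b) :=
    integrable_kernelMeasure hs hb hh.continuousOn
  rw [integral_finsetSum _ fun i _ => hint (by fun_prop)]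
  refine Finset.sum_congr rfl fun i _ => ?_
  rw [integral_finsetSum _ fun j _ => hint (by fun_prop)]
  simp_rw [integral_mul_const]

theorem exists_abs_bias_le (hf : ContDiffOn ℝ 2 f (simplex d)) :
    ∃ C, 0 ≤ C ∧ ∀ s ∈ simplex d, ∀ b > 0, |∫ x, f x ∂(kernelMeasure s b) - f s| ≤ C * b := by
  obtain ⟨L, hL0, hL⟩ := exists_lipschitz_fderivWithin_simplex hf
  obtain ⟨C, hC0, hC⟩ := exists_integral_norm_sub_pow_kernelMeasure_le d 1
  choose D hD0 hD using fun i =>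
    exists_abs_le_of_continuousOn_simplex (contDiffOn_pderiv hf i).continuousOn
  have hD' : 0 ≤ ∑ i, D i := Finset.sum_nonneg fun i _ => hD0 i
  refine ⟨L * C + (d + 1) * ∑ i, D i, by positivity, fun s hs b hb => ?_⟩
  set T : (Fin d → ℝ) → ℝ := fun x => ∑ i, (x i - s i) * pderiv i f s
  have hT : Continuous T := by fun_prop
  have hremainder : |∫ x, f x ∂(kernelMeasure s b) - f s - ∫ x, T x ∂(kernelMeasure s b)| ≤
      L * (C * b) := by
    rw [← integral_sub_sub_kernelMeasure hs hb hf.continuousOn hT]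
    calc |∫ x, (f x - f s - T x) ∂(kernelMeasure s b)|
        ≤ ∫ x, L * ‖x - s‖ ^ 2 ∂(kernelMeasure s b) := by
          refine abs_integral_kernelMeasure_le hs hb (Continuous.continuousOn (by fun_prop))
            fun x hx => ?_
          simpa only [fderivWithin_apply_eq_sum_pderiv, Real.norm_eq_abs, Pi.sub_apply] using
            norm_sub_taylor_one_le_of_lipschitz convex_simplex (hasFDerivWithinAt_simplex hf)
              hL0 hL hs hx
      _ = L * ∫ x, ‖x - s‖ ^ 2 ∂(kernelMeasure s b) := integral_const_mul ..
      _ ≤ L * (C * b) := by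
          gcongr
          simpa using hC s hs b hb
  have hdrift : |∫ x, T x ∂(kernelMeasure s b)| ≤ (d + 1) * b * ∑ i, D i := by
    rw [integral_sum_sub_mul_kernelMeasure hs hb, Finset.mul_sum]
    refine (Finset.abs_sum_le_sum_abs _ _).trans (Finset.sum_le_sum fun i _ => ?_)
    rw [abs_mul]
    gcongr
    exacts [abs_integral_sub_kernelMeasure_le hs hb i, hD i s hs]
  linarith [abs_sub_abs_le_abs_sub (∫ x, f x ∂(kernelMeasure s b) - f s)
    (∫ x, T x ∂(kernelMeasure s b))]

theorem tendsto_bias_div (hf : ContDiffOn ℝ 2 f (simplex d)) (hs : s ∈ simplex d) :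
    Tendsto (fun b => (∫ x, f x ∂(kernelMeasure s b) - f s) / b) (𝓝[>] 0)
      (𝓝 (biasCoeff f s)) := by
  set T : (Fin d → ℝ) → ℝ := fun x => ∑ i, (x i - s i) * pderiv i f s +
    1 / 2 * ∑ i, ∑ j, (x i - s i) * (x j - s j) * pderiv i (pderiv j f) s with hTdef
  have hT : Continuous T := by fun_prop
  have htaylor : (fun x => f x - f s - T x) =o[𝓝[simplex d] s] fun x => ‖x - s‖ ^ (2 * 1) := by
    refine (isLittleO_sub_taylor_two convex_simplex (hasFDerivWithinAt_simplex hf) hs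
      (hasFDerivWithinAt_fderivWithin_simplex hf s hs)).congr_left fun x => ?_
    simp only [fderivWithin_fderivWithin_apply_eq_sum_pderiv hf hs,
      fderivWithin_apply_eq_sum_pderiv, Pi.sub_apply, smul_eq_mul, hTdef]
    ring
  have hremainder : Tendsto (fun b => (∫ x, (f x - f s - T x) ∂(kernelMeasure s b)) / b)
      (𝓝[>] 0) (𝓝 0) := by
    simpa using (isLittleO_integral_kernelMeasure hs ((hf.continuousOn.sub
      continuousOn_const).sub hT.continuousOn) 1 htaylor).tendsto_div_nhds_zero
  have hmoments : Tendsto (fun b =>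
      ∑ i, (∫ x, (x i - s i) ∂(kernelMeasure s b)) / b * pderiv i f s +
        1 / 2 * ∑ i, ∑ j, (∫ x, (x i - s i) * (x j - s j) ∂(kernelMeasure s b)) / b *
          pderiv i (pderiv j f) s) (𝓝[>] 0) (𝓝 (biasCoeff f s)) :=
    (tendsto_finsetSum _ fun i _ =>
      (tendsto_integral_sub_kernelMeasure_div hs i).mul_const _).add
      ((tendsto_finsetSum _ fun i _ => tendsto_finsetSum _ fun j _ =>
        (tendsto_integral_sub_mul_sub_kernelMeasure_div hs i j).mul_const _).const_mul _)
  rw [← zero_add (biasCoeff f s)]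
  refine (hremainder.add hmoments).congr' (eventually_mem_nhdsWithin.mono fun b hb => ?_)
  have hTint : ∫ x, T x ∂(kernelMeasure s b) =
      ∑ i, (∫ x, (x i - s i) ∂(kernelMeasure s b)) * pderiv i f s +
        1 / 2 * ∑ i, ∑ j, (∫ x, (x i - s i) * (x j - s j) ∂(kernelMeasure s b)) *
          pderiv i (pderiv j f) s := by
    rw [integral_add, integral_const_mul, integral_sum_sub_mul_kernelMeasure hs hb,
      integral_sum_sum_sub_mul_sub_mul_kernelMeasure hs hb] <;>
    exact integrable_kernelMeasure hs hb (Continuous.continuousOn (by fun_prop))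
  simp only [integral_sub_sub_kernelMeasure hs hb hf.continuousOn hT, hTint, div_mul_eq_mul_div,
    ← Finset.sum_div]
  ring

end Bias

/-! ### The square of the kernel -/

/-- The ratio `Γ(x + 1/2) / Γ(x + 1)`, which by Legendre's duplication formula governs the
generalised central binomial coefficient `Γ(2x + 1) / Γ(x + 1)²` and which behaves like `1 / √x`
for large `x`. -/
noncomputable def gammaRatio (x : ℝ) : ℝ := Real.Gamma (x + 1 / 2) / Real.Gamma (x + 1)

theorem gammaRatio_pos {x : ℝ} (hx : 0 ≤ x) : 0 < gammaRatio x :=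
  div_pos (Real.Gamma_pos_of_pos (by positivity)) (Real.Gamma_pos_of_pos (by positivity))

theorem Gamma_two_mul_add_one_div_sq {x : ℝ} (hx : 0 ≤ x) :
    Real.Gamma (2 * x + 1) / Real.Gamma (x + 1) ^ 2 = 4 ^ x * gammaRatio x / √Real.pi := by
  have := Real.Gamma_pos_of_pos (by positivity : 0 < x + 1)
  have hfour : (2 : ℝ) ^ (1 - 2 * (x + 1 / 2)) = (4 ^ x)⁻¹ := by
    rw [show 1 - 2 * (x + 1 / 2) = 2 * -x by ring, Real.rpow_mul two_pos.le,
      Real.rpow_neg (by positivity)]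
    norm_num
  have hdup := Real.Gamma_mul_Gamma_add_half (x + 1 / 2)
  rw [show x + 1 / 2 + 1 / 2 = x + 1 by ring, show 2 * (x + 1 / 2) = 2 * x + 1 by ring] at hdup
  rw [show 1 - (2 * x + 1) = 1 - 2 * (x + 1 / 2) by ring, hfour] at hdup
  rw [gammaRatio]
  field_simp at hdup ⊢
  linarith

theorem Gamma_add_half_sq_le {x : ℝ} (hx : 0 < x) :
    Real.Gamma (x + 1 / 2) ^ 2 ≤ Real.Gamma x * Real.Gamma (x + 1) := by
  have hΓ := Real.Gamma_pos_of_pos hx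
  have hΓ' := Real.Gamma_pos_of_pos (by positivity : 0 < x + 1)
  have hΓhalf := Real.Gamma_pos_of_pos (by positivity : 0 < x + 1 / 2)
  have hconvex := Real.Gamma_mul_add_mul_le_rpow_Gamma_mul_rpow_Gamma hx
    (by positivity : 0 < x + 1) one_half_pos one_half_pos (add_halves 1)
  rw [← Real.mul_rpow hΓ.le hΓ'.le, ← Real.sqrt_eq_rpow,
    show 1 / 2 * x + 1 / 2 * (x + 1) = x + 1 / 2 by ring] at hconvex
  exact (Real.le_sqrt hΓhalf.le (by positivity)).1 hconvex

theorem rpow_neg_half_eq_sqrt_inv {x : ℝ} (hx : 0 ≤ x) : x ^ (-(1 / 2) : ℝ) = √x⁻¹ := by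
  rw [Real.rpow_neg hx, ← Real.sqrt_eq_rpow, Real.sqrt_inv]

theorem gammaRatio_le {x : ℝ} (hx : 0 < x) : gammaRatio x ≤ x ^ (-(1 / 2) : ℝ) := by
  have := Real.Gamma_pos_of_pos hx
  rw [rpow_neg_half_eq_sqrt_inv hx.le, gammaRatio]
  refine Real.le_sqrt_of_sq_le ?_
  calc
    (Real.Gamma (x + 1 / 2) / Real.Gamma (x + 1)) ^ 2
        ≤ Real.Gamma x * Real.Gamma (x + 1) / Real.Gamma (x + 1) ^ 2 := by
      rw [div_pow]
      gcongr
      exact Gamma_add_half_sq_le hx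
    _ = x⁻¹ := by
      rw [Real.Gamma_add_one hx.ne']
      field_simp

theorem le_gammaRatio {x : ℝ} (hx : 0 ≤ x) : (x + 1 / 2) ^ (-(1 / 2) : ℝ) ≤ gammaRatio x := by
  have hx' : 0 < x + 1 / 2 := by positivity
  have := Real.Gamma_pos_of_pos hx'
  have := Real.Gamma_pos_of_pos (by positivity : 0 < x + 1)
  have h := Gamma_add_half_sq_le hx'
  rw [rpow_neg_half_eq_sqrt_inv hx'.le, gammaRatio]
  refine Real.sqrt_le_iff.2 ⟨by positivity, ?_⟩
  rw [Real.Gamma_add_one hx'.ne', add_assoc, add_halves] at h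
  rw [div_pow, le_div_iff₀ (by positivity), inv_mul_le_iff₀ hx']
  linarith

section Scaling

variable {a : ℝ} (ha : 0 < a)

include ha

theorem rpow_neg_half_div_sqrt {b : ℝ} (hb : 0 < b) :
    (a / b) ^ (-(1 / 2) : ℝ) / √b = a ^ (-(1 / 2) : ℝ) := by
  rw [rpow_neg_half_eq_sqrt_inv (by positivity), rpow_neg_half_eq_sqrt_inv ha.le,
    ← Real.sqrt_div' _ hb.le, inv_div, div_right_comm, div_self hb.ne', one_div]

theorem gammaRatio_div_sqrt_le {b : ℝ} (hb : 0 < b) :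
    gammaRatio (a / b) / √b ≤ a ^ (-(1 / 2) : ℝ) := by
  rw [← rpow_neg_half_div_sqrt ha hb]
  gcongr
  exact gammaRatio_le (by positivity)

theorem tendsto_gammaRatio_div_sqrt :
    Tendsto (fun b => gammaRatio (a / b) / √b) (𝓝[>] 0) (𝓝 (a ^ (-(1 / 2) : ℝ))) := by
  have hlower : Tendsto (fun b => (a + b / 2) ^ (-(1 / 2) : ℝ)) (𝓝[>] 0)
      (𝓝 (a ^ (-(1 / 2) : ℝ))) := by
    have hcont : ContinuousAt (fun b : ℝ => (a + b / 2) ^ (-(1 / 2) : ℝ)) 0 :=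
      ContinuousAt.rpow_const (by fun_prop) (Or.inl (by simpa using ha.ne'))
    simpa using hcont.tendsto.mono_left nhdsWithin_le_nhds
  refine tendsto_of_tendsto_of_tendsto_of_le_of_le' hlower tendsto_const_nhds
    (eventually_mem_nhdsWithin.mono fun b hb => ?_)
    (eventually_mem_nhdsWithin.mono fun b hb => gammaRatio_div_sqrt_le ha hb)
  have hb : 0 < b := hb
  rw [← rpow_neg_half_div_sqrt (by positivity) hb, add_div, div_div_cancel_left' hb.ne', ← one_div]
  gcongr
  exact le_gammaRatio (by positivity)

end Scaling

/-- The normalising constant `Γ(1/b + d + 1)² / Γ(2/b + d + 1)` that appears when the kernel is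
squared, rescaled so that it tends to `1` as `b → 0`. -/
noncomputable def normFactor (d : ℕ) (b : ℝ) : ℝ :=
  2 ^ d / √Real.pi * (b ^ d * √b * 4 ^ (1 / b) *
    (Real.Gamma (1 / b + (d + 1)) ^ 2 / Real.Gamma (2 / b + (d + 1))))

theorem normFactor_pos (d : ℕ) {b : ℝ} (hb : 0 < b) : 0 < normFactor d b := by
  have := Real.Gamma_pos_of_pos (by positivity : 0 < 1 / b + ((d : ℝ) + 1))
  have := Real.Gamma_pos_of_pos (by positivity : 0 < 2 / b + ((d : ℝ) + 1))
  unfold normFactor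
  positivity

theorem normFactor_zero {b : ℝ} (hb : 0 < b) :
    normFactor 0 b = (gammaRatio (1 / b) / √b)⁻¹ := by
  have hratio := gammaRatio_pos (x := 1 / b) (by positivity)
  have hcentral := congrArg (·⁻¹) (Gamma_two_mul_add_one_div_sq (x := 1 / b) (by positivity))
  simp only [inv_div, mul_one_div] at hcentral
  simp only [normFactor, pow_zero, one_mul, Nat.cast_zero, zero_add, hcentral]
  field_simp

theorem normFactor_succ (d : ℕ) {b : ℝ} (hb : 0 < b) :
    normFactor (d + 1) b =
      normFactor d b * (2 * (1 + (d + 1) * b) ^ 2 / (2 + (d + 1) * b)) := by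
  have := Real.Gamma_pos_of_pos (by positivity : 0 < 1 / b + ((d : ℝ) + 1))
  have := Real.Gamma_pos_of_pos (by positivity : 0 < 2 / b + ((d : ℝ) + 1))
  have harg (c : ℝ) : c / b + (d + 1) = (c + (d + 1) * b) / b := by field_simp
  simp only [normFactor, Nat.cast_succ]
  rw [← add_assoc (1 / b), ← add_assoc (2 / b),
    Real.Gamma_add_one (by positivity : 1 / b + ((d : ℝ) + 1) ≠ 0),
    Real.Gamma_add_one (by positivity : 2 / b + ((d : ℝ) + 1) ≠ 0)]
  generalize Real.Gamma (1 / b + (d + 1)) = g₁ at *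
  generalize Real.Gamma (2 / b + (d + 1)) = g₂ at *
  rw [harg, harg]
  field_simp
  ring

theorem tendsto_normFactor (d : ℕ) : Tendsto (normFactor d) (𝓝[>] 0) (𝓝 1) := by
  induction d with
  | zero =>
    have hlim := (tendsto_gammaRatio_div_sqrt one_pos).inv₀ (by simp)
    simp only [Real.one_rpow, inv_one] at hlim
    exact hlim.congr' (eventually_mem_nhdsWithin.mono fun b hb => (normFactor_zero hb).symm)
  | succ d ih =>
    have hcont : ContinuousAt
        (fun b : ℝ => 2 * (1 + (d + 1) * b) ^ 2 / (2 + (d + 1) * b)) 0 :=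
      ContinuousAt.div (by fun_prop) (by fun_prop) (by simp)
    have hlim := ih.mul (hcont.tendsto.mono_left (nhdsWithin_le_nhds (s := Set.Ioi 0)))
    simp only [mul_zero, add_zero, one_pow, mul_one, div_self (two_ne_zero' ℝ)] at hlim
    exact hlim.congr' (eventually_mem_nhdsWithin.mono fun b hb => (normFactor_succ d hb).symm)

/-- The constant by which the square of the `Dirichlet(α, β)` density differs from the
`Dirichlet(2α - 1, 2β - 1)` density. -/
noncomputable def dirichletSqFactor (α : Fin d → ℝ) (β : ℝ) : ℝ :=
  Real.Gamma (l1 α + β) ^ 2 / Real.Gamma (l1 (fun i => 2 * α i - 1) + (2 * β - 1)) *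
    (Real.Gamma (2 * β - 1) / Real.Gamma β ^ 2 *
      ∏ i, Real.Gamma (2 * α i - 1) / Real.Gamma (α i) ^ 2)

theorem dirichletDensity_sq {α : Fin d → ℝ} {β : ℝ} (hα : ∀ i, 0 < 2 * α i - 1)
    (hβ : 0 < 2 * β - 1) {x : Fin d → ℝ} (hx : x ∈ simplex d) :
    dirichletDensity α β x ^ 2 =
      dirichletSqFactor α β * dirichletDensity (fun i => 2 * α i - 1) (2 * β - 1) x := by
  have hpow {y : ℝ} (hy : 0 ≤ y) (a : ℝ) : (y ^ (a - 1)) ^ 2 = y ^ (2 * a - 1 - 1) := by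
    rw [← Real.rpow_natCast, ← Real.rpow_mul hy]
    congr 1
    push_cast
    ring
  have hΓ : Real.Gamma (l1 (fun i => 2 * α i - 1) + (2 * β - 1)) ≠ 0 :=
    (Real.Gamma_pos_of_pos (add_pos_of_nonneg_of_pos (l1_nonneg _) hβ)).ne'
  have hΓβ : Real.Gamma (2 * β - 1) ≠ 0 := (Real.Gamma_pos_of_pos hβ).ne'
  have hΓα : ∏ i, Real.Gamma (2 * α i - 1) ≠ 0 :=
    Finset.prod_ne_zero_iff.2 fun i _ => (Real.Gamma_pos_of_pos (hα i)).ne'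
  simp only [dirichletDensity, dirichletSqFactor, mul_pow, div_pow, ← Finset.prod_pow,
    Finset.prod_div_distrib, hpow (one_sub_l1_nonneg hx), hpow (coord_nonneg_of_mem_simplex hx _)]
  generalize Real.Gamma (l1 (fun i => 2 * α i - 1) + (2 * β - 1)) = g at *
  generalize Real.Gamma (2 * β - 1) = gβ at *
  generalize ∏ i, Real.Gamma (2 * α i - 1) = gα at *
  field_simp

/-- The constant by which the square of the kernel with bandwidth `b` differs from the kernel with
bandwidth `b / 2`. -/
noncomputable def kernelSqFactor (s : Fin d → ℝ) (b : ℝ) : ℝ :=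
  dirichletSqFactor (fun i => s i / b + 1) ((1 - l1 s) / b + 1)

theorem mem_simplex_of_pos_of_l1_lt_one {s : Fin d → ℝ} (hs0 : ∀ i, 0 < s i) (hs1 : l1 s < 1) :
    s ∈ simplex d :=
  ⟨fun i => ⟨(hs0 i).le, (le_abs_self _).trans <|
    (Finset.single_le_sum (f := fun i => |s i|) (fun _ _ => abs_nonneg _)
      (Finset.mem_univ i)).trans hs1.le⟩, hs1.le⟩

section KernelSq

variable {s : Fin d → ℝ} {b : ℝ}

theorem kernel_sq (hs : s ∈ simplex d) (hb : 0 < b) {x : Fin d → ℝ} (hx : x ∈ simplex d) :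
    dirichletDensity (fun i => s i / b + 1) ((1 - l1 s) / b + 1) x ^ 2 = kernelSqFactor s b *
      dirichletDensity (fun i => s i / (b / 2) + 1) ((1 - l1 s) / (b / 2) + 1) x := by
  have hhalf (a : ℝ) : a / (b / 2) + 1 = 2 * (a / b + 1) - 1 := by ring
  simp only [hhalf, kernelSqFactor]
  refine dirichletDensity_sq (fun i => ?_) ?_ hx
  · exact hhalf (s i) ▸ coord_div_add_one_pos hs (half_pos hb) i
  · exact hhalf (1 - l1 s) ▸ one_sub_l1_div_add_one_pos hs (half_pos hb)

theorem kernelSqFactor_eq (hs : s ∈ simplex d) (hb : 0 < b) :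
    kernelSqFactor s b = Real.Gamma (1 / b + (d + 1)) ^ 2 / Real.Gamma (2 / b + (d + 1)) *
      (4 ^ (1 / b) / √Real.pi ^ (d + 1) *
        (gammaRatio ((1 - l1 s) / b) * ∏ i, gammaRatio (s i / b))) := by
  have hs0 (i : Fin d) : 0 ≤ s i / b := div_nonneg (coord_nonneg_of_mem_simplex hs i) hb.le
  have hs1 : 0 ≤ (1 - l1 s) / b := div_nonneg (one_sub_l1_nonneg hs) hb.le
  have hdouble (a : ℝ) : 2 * (a / b + 1) - 1 = a / (b / 2) + 1 := by ring
  have hdouble' (a : ℝ) : a / (b / 2) + 1 = 2 * (a / b) + 1 := by ring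
  have hfour : (4 : ℝ) ^ (1 / b) = 4 ^ ((1 - l1 s) / b) * ∏ i, 4 ^ (s i / b) := by
    rw [← Real.rpow_sum_of_pos (by norm_num), ← Real.rpow_add (by norm_num), ← Finset.sum_div,
      ← add_div, ← l1_eq_sum_of_mem_simplex hs, sub_add_cancel]
  simp only [kernelSqFactor, dirichletSqFactor, hdouble, l1_div_add_one_add hs hb,
    l1_div_add_one_add hs (half_pos hb), one_div_div]
  simp only [hdouble', Gamma_two_mul_add_one_div_sq hs1, Gamma_two_mul_add_one_div_sq (hs0 _),
    Finset.prod_div_distrib, Finset.prod_mul_distrib, Finset.prod_const, Finset.card_univ,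
    Fintype.card_fin, hfour]
  field_simp
  ring

theorem sqrt_pow_mul_kernelSqFactor (hs : s ∈ simplex d) (hb : 0 < b) :
    √b ^ d * kernelSqFactor s b = normFactor d b * ((1 / (2 * √Real.pi)) ^ d *
      (gammaRatio ((1 - l1 s) / b) / √b * ∏ i, gammaRatio (s i / b) / √b)) := by
  have hsqrt : b ^ d = √b ^ d * √b ^ d := by rw [← mul_pow, Real.mul_self_sqrt hb.le]
  simp only [kernelSqFactor_eq hs hb, normFactor, hsqrt, Finset.prod_div_distrib,
    Finset.prod_const, Finset.card_univ, Fintype.card_fin, div_pow, one_pow, mul_pow]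
  field_simp
  ring

theorem kernelSqFactor_nonneg (hs : s ∈ simplex d) (hb : 0 < b) : 0 ≤ kernelSqFactor s b := by
  have := Real.Gamma_pos_of_pos (by positivity : 0 < 2 / b + ((d : ℝ) + 1))
  have hratio := gammaRatio_pos (div_nonneg (one_sub_l1_nonneg hs) hb.le)
  have hratios : 0 < ∏ i, gammaRatio (s i / b) := Finset.prod_pos fun i _ =>
    gammaRatio_pos (div_nonneg (coord_nonneg_of_mem_simplex hs i) hb.le)
  rw [kernelSqFactor_eq hs hb]
  positivity

theorem psi_eq (hs : s ∈ simplex d) :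
    psi s = (1 / (2 * √Real.pi)) ^ d *
      ((1 - l1 s) ^ (-(1 / 2) : ℝ) * ∏ i, s i ^ (-(1 / 2) : ℝ)) := by
  have hprod : 0 ≤ ∏ i, s i := Finset.prod_nonneg fun i _ => coord_nonneg_of_mem_simplex hs i
  have hconst : ((4 * Real.pi) ^ d) ^ (-(1 / 2) : ℝ) = (1 / (2 * √Real.pi)) ^ d := by
    rw [rpow_neg_half_eq_sqrt_inv (by positivity),
      show ((4 * Real.pi) ^ d)⁻¹ = ((1 / (2 * √Real.pi)) ^ d) ^ 2 by
        rw [pow_right_comm, div_pow, mul_pow _ √Real.pi, Real.sq_sqrt Real.pi_pos.le, one_pow,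
          one_div, inv_pow]
        norm_num,
      Real.sqrt_sq (by positivity)]
  rw [psi, Real.mul_rpow (mul_nonneg (by positivity) (one_sub_l1_nonneg hs)) hprod,
    Real.mul_rpow (by positivity) (one_sub_l1_nonneg hs), hconst, mul_assoc,
    Real.finsetProd_rpow _ _ fun i _ => coord_nonneg_of_mem_simplex hs i]

theorem psi_nonneg (hs : s ∈ simplex d) : 0 ≤ psi s :=
  Real.rpow_nonneg (mul_nonneg (mul_nonneg (by positivity) (one_sub_l1_nonneg hs))
    (Finset.prod_nonneg fun i _ => coord_nonneg_of_mem_simplex hs i)) _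

theorem sqrt_pow_mul_kernelSqFactor_le (hs0 : ∀ i, 0 < s i) (hs1 : l1 s < 1) (hb : 0 < b) :
    √b ^ d * kernelSqFactor s b ≤ normFactor d b * psi s := by
  have hs := mem_simplex_of_pos_of_l1_lt_one hs0 hs1
  have hratio (i : Fin d) : 0 ≤ gammaRatio (s i / b) / √b :=
    div_nonneg (gammaRatio_pos (div_nonneg (hs0 i).le hb.le)).le (Real.sqrt_nonneg b)
  have hnorm := (normFactor_pos d hb).le
  rw [sqrt_pow_mul_kernelSqFactor hs hb, psi_eq hs]
  gcongr
  · exact Finset.prod_nonneg fun i _ => hratio i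
  · exact gammaRatio_div_sqrt_le (sub_pos.2 hs1) hb
  · exact fun i _ => hratio i
  · exact gammaRatio_div_sqrt_le (hs0 _) hb

theorem tendsto_sqrt_pow_mul_kernelSqFactor (hs0 : ∀ i, 0 < s i) (hs1 : l1 s < 1) :
    Tendsto (fun b => √b ^ d * kernelSqFactor s b) (𝓝[>] 0) (𝓝 (psi s)) := by
  have hs := mem_simplex_of_pos_of_l1_lt_one hs0 hs1
  have hlim := (tendsto_normFactor d).mul
    (((tendsto_gammaRatio_div_sqrt (sub_pos.2 hs1)).mul (tendsto_finsetProd Finset.univ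
      fun i _ => tendsto_gammaRatio_div_sqrt (hs0 i))).const_mul ((1 / (2 * √Real.pi)) ^ d))
  rw [one_mul, ← psi_eq hs] at hlim
  exact hlim.congr' (eventually_mem_nhdsWithin.mono fun b hb =>
    (sqrt_pow_mul_kernelSqFactor hs hb).symm)

end KernelSq

/-! ### The weight `ψ` -/

theorem volume_sum_eq_one (d : ℕ) : volume {s : Fin d → ℝ | ∑ i, s i = 1} = 0 := by
  let H : AffineSubspace ℝ (Fin d → ℝ) :=
    { carrier := {s | ∑ i, s i = 1}
      smul_vsub_vadd_mem' := by
        intro c p₁ p₂ p₃ h₁ h₂ h₃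
        simp only [Set.mem_ofPred_eq] at h₁ h₂ h₃
        simp [Finset.sum_add_distrib, ← Finset.mul_sum, h₁, h₂, h₃] }
  refine Measure.addHaar_affineSubspace volume H fun htop => ?_
  have hzero : (0 : Fin d → ℝ) ∈ H := htop ▸ AffineSubspace.mem_top ℝ _ _
  have hsum : ∑ i, (0 : Fin d → ℝ) i = 1 := hzero
  simp at hsum

theorem ae_simplex_pos_and_l1_lt_one :
    ∀ᵐ s ∂(volume.restrict (simplex d)), (∀ i, 0 < s i) ∧ l1 s < 1 := by
  have hface : ∀ᵐ s : Fin d → ℝ, ∑ i, s i ≠ 1 := by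
    rw [ae_iff]
    simpa using volume_sum_eq_one d
  have hcoord : ∀ᵐ s : Fin d → ℝ, ∀ i, s i ≠ 0 := by
    refine ae_all_iff.2 fun i => ?_
    rw [ae_iff]
    simpa [volume_pi] using Measure.pi_hyperplane (fun _ : Fin d => (volume : Measure ℝ)) i 0
  filter_upwards [ae_restrict_of_ae hface, ae_restrict_of_ae hcoord,
    ae_restrict_mem measurableSet_simplex] with s hface hcoord hs
  exact ⟨fun i => (coord_nonneg_of_mem_simplex hs i).lt_of_ne' (hcoord i),
    hs.2.lt_of_ne (l1_eq_sum_of_mem_simplex hs ▸ hface)⟩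

theorem psi_pos {s : Fin d → ℝ} (hs0 : ∀ i, 0 < s i) (hs1 : l1 s < 1) : 0 < psi s :=
  Real.rpow_pos_of_pos (mul_pos (mul_pos (by positivity) (sub_pos.2 hs1))
    (Finset.prod_pos fun i _ => hs0 i)) _

theorem integrableOn_psi : IntegrableOn psi (simplex d) := by
  set c := Real.Gamma (l1 (fun _ : Fin d => 1 / 2) + 1 / 2) /
    (Real.Gamma (1 / 2) * ∏ _i : Fin d, Real.Gamma (1 / 2)) with hc
  have hc0 : c ≠ 0 :=
    (div_pos (Real.Gamma_pos_of_pos (add_pos_of_nonneg_of_pos (l1_nonneg _) one_half_pos))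
      (mul_pos (Real.Gamma_pos_of_pos one_half_pos)
        (Finset.prod_pos fun _ _ => Real.Gamma_pos_of_pos one_half_pos))).ne'
  refine IntegrableOn.congr_fun ((integrableOn_dirichletDensity (α := fun _ => 1 / 2)
    (fun _ => one_half_pos) one_half_pos).const_mul (c⁻¹ * (1 / (2 * √Real.pi)) ^ d))
    (fun s hs => ?_) measurableSet_simplex
  simp only [psi_eq hs, dirichletDensity, ← hc, show (1 / 2 - 1 : ℝ) = -(1 / 2) by norm_num]
  field_simp

section Integrals

variable {f : (Fin d → ℝ) → ℝ}

theorem integrableOn_psi_mul (hf : ContinuousOn f (simplex d)) :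
    IntegrableOn (fun s => psi s * f s) (simplex d) := by
  obtain ⟨C, -, hC⟩ := exists_abs_le_of_continuousOn_simplex hf
  exact Integrable.mul_bdd integrableOn_psi (hf.aestronglyMeasurable measurableSet_simplex)
    ((ae_restrict_mem measurableSet_simplex).mono hC)

theorem integral_psi_mul_pos (hf_nonneg : ∀ s ∈ simplex d, 0 ≤ f s)
    (hf : ContinuousOn f (simplex d)) (hf_pos : 0 < ∫ s in simplex d, f s) :
    0 < ∫ s in simplex d, psi s * f s := by
  have hnonneg : 0 ≤ᵐ[volume.restrict (simplex d)] fun s => psi s * f s :=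
    (ae_restrict_mem measurableSet_simplex).mono fun s hs =>
      mul_nonneg (psi_nonneg hs) (hf_nonneg s hs)
  refine (integral_nonneg_of_ae hnonneg).lt_of_ne' fun hzero => hf_pos.ne' ?_
  rw [integral_eq_zero_iff_of_nonneg_ae hnonneg (integrableOn_psi_mul hf)] at hzero
  refine integral_eq_zero_of_ae ?_
  filter_upwards [hzero, ae_simplex_pos_and_l1_lt_one] with s hs hpos
  exact (mul_eq_zero.1 hs).resolve_left (psi_pos hpos.1 hpos.2).ne'

/-! ### The integrated second moment of the kernel -/

theorem stronglyMeasurable_integral_kernel_pow_mul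
    (hf : AEStronglyMeasurable f (volume.restrict (simplex d))) (b : ℝ) (k : ℕ) :
    StronglyMeasurable fun s => ∫ x in simplex d,
      dirichletDensity (fun i => s i / b + 1) ((1 - l1 s) / b + 1) x ^ k * f x := by
  have hcongr (s : Fin d → ℝ) : ∫ x in simplex d,
      dirichletDensity (fun i => s i / b + 1) ((1 - l1 s) / b + 1) x ^ k * f x =
      ∫ x in simplex d,
        dirichletDensity (fun i => s i / b + 1) ((1 - l1 s) / b + 1) x ^ k * hf.mk f x :=
    integral_congr_ae (hf.ae_eq_mk.mono fun x hx => by simp only [hx])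
  simp only [hcongr]
  have hl1 := measurable_l1 (d := d)
  have hkernel : Measurable fun p : (Fin d → ℝ) × (Fin d → ℝ) =>
      dirichletDensity (fun i => p.1 i / b + 1) ((1 - l1 p.1) / b + 1) p.2 :=
    measurable_dirichletDensity_comp (by fun_prop) (by fun_prop) measurable_snd
  exact ((hkernel.pow_const k).mul (hf.stronglyMeasurable_mk.measurable.comp
    measurable_snd)).stronglyMeasurable.integral_prod_right'

/-- The second moment under the density `f` of the kernel of the estimator at `s`, which governs the
variance of the estimator. -/
noncomputable def secondMoment (f : (Fin d → ℝ) → ℝ) (b : ℝ) (s : Fin d → ℝ) : ℝ :=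
  ∫ x in simplex d, dirichletDensity (fun i => s i / b + 1) ((1 - l1 s) / b + 1) x ^ 2 * f x

theorem secondMoment_eq {s : Fin d → ℝ} (hs : s ∈ simplex d) {b : ℝ} (hb : 0 < b) :
    secondMoment f b s = kernelSqFactor s b * ∫ x, f x ∂(kernelMeasure s (b / 2)) := by
  rw [kernelMeasure, integral_dirichletMeasure (coord_div_add_one_pos hs (half_pos hb))
    (one_sub_l1_div_add_one_pos hs (half_pos hb)), ← integral_const_mul, secondMoment]
  refine setIntegral_congr_fun measurableSet_simplex fun x hx => ?_
  simp only [kernel_sq hs hb hx, mul_assoc]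

theorem abs_integral_kernelMeasure_le_of_forall_abs_le {s : Fin d → ℝ} (hs : s ∈ simplex d) {b : ℝ}
    (hb : 0 < b) {C : ℝ} (hC : ∀ x ∈ simplex d, |f x| ≤ C) :
    |∫ x, f x ∂(kernelMeasure s b)| ≤ C := by
  have := isProbabilityMeasure_kernelMeasure hs hb
  exact (abs_integral_kernelMeasure_le hs hb (k := fun _ => C) continuousOn_const hC).trans
    (by simp)

theorem abs_sqrt_pow_mul_secondMoment_le {C : ℝ} (hC : ∀ x ∈ simplex d, |f x| ≤ C)
    {s : Fin d → ℝ} (hs0 : ∀ i, 0 < s i) (hs1 : l1 s < 1) {b : ℝ} (hb : 0 < b) :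
    |√b ^ d * secondMoment f b s| ≤ normFactor d b * psi s * C := by
  have hs := mem_simplex_of_pos_of_l1_lt_one hs0 hs1
  have hfactor : 0 ≤ √b ^ d * kernelSqFactor s b :=
    mul_nonneg (by positivity) (kernelSqFactor_nonneg hs hb)
  rw [secondMoment_eq hs hb, ← mul_assoc, abs_mul, abs_of_nonneg hfactor]
  exact mul_le_mul (sqrt_pow_mul_kernelSqFactor_le hs0 hs1 hb)
    (abs_integral_kernelMeasure_le_of_forall_abs_le hs (half_pos hb) hC) (abs_nonneg _)
    (mul_nonneg (normFactor_pos d hb).le (psi_nonneg hs))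

theorem integrableOn_secondMoment (hf : ContinuousOn f (simplex d)) {b : ℝ} (hb : 0 < b) :
    IntegrableOn (secondMoment f b) (simplex d) := by
  obtain ⟨C, -, hC⟩ := exists_abs_le_of_continuousOn_simplex hf
  have hsqrt : IsUnit (√b ^ d) := (pow_pos (Real.sqrt_pos.2 hb) d).ne'.isUnit
  refine (integrable_const_mul_iff hsqrt _).1 (((integrableOn_psi.const_mul
    (normFactor d b)).mul_const C).mono' ?_ ?_)
  · exact (stronglyMeasurable_integral_kernel_pow_mul (hf.aestronglyMeasurable
      measurableSet_simplex) b 2).aestronglyMeasurable.const_mul _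
  · exact ae_simplex_pos_and_l1_lt_one.mono fun s hs =>
      abs_sqrt_pow_mul_secondMoment_le hC hs.1 hs.2 hb

theorem tendsto_half_nhdsGT_zero : Tendsto (fun b : ℝ => b / 2) (𝓝[>] 0) (𝓝[>] 0) := by
  have hlim : Tendsto (fun b : ℝ => b / 2) (𝓝 0) (𝓝 0) :=
    (continuous_id.div_const (2 : ℝ)).tendsto' 0 0 (by simp)
  exact tendsto_nhdsWithin_iff.2 ⟨hlim.mono_left nhdsWithin_le_nhds,
    eventually_mem_nhdsWithin.mono fun b (hb : 0 < b) => half_pos hb⟩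

theorem tendsto_sqrt_pow_mul_secondMoment (hf : ContinuousOn f (simplex d)) {s : Fin d → ℝ}
    (hs0 : ∀ i, 0 < s i) (hs1 : l1 s < 1) :
    Tendsto (fun b => √b ^ d * secondMoment f b s) (𝓝[>] 0) (𝓝 (psi s * f s)) := by
  have hs := mem_simplex_of_pos_of_l1_lt_one hs0 hs1
  refine ((tendsto_sqrt_pow_mul_kernelSqFactor hs0 hs1).mul
    ((tendsto_integral_kernelMeasure hs hf).comp tendsto_half_nhdsGT_zero)).congr'
    (eventually_mem_nhdsWithin.mono fun b hb => ?_)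
  simp only [secondMoment_eq hs hb, mul_assoc, Function.comp_apply]

theorem tendsto_integral_secondMoment (hf : ContinuousOn f (simplex d)) :
    Tendsto (fun b => √b ^ d * ∫ s in simplex d, secondMoment f b s) (𝓝[>] 0)
      (𝓝 (∫ s in simplex d, psi s * f s)) := by
  obtain ⟨C, hC0, hC⟩ := exists_abs_le_of_continuousOn_simplex hf
  simp only [← integral_const_mul]
  refine tendsto_integral_filter_of_dominated_convergence (fun s => 2 * psi s * C) ?_ ?_
    ((integrableOn_psi.const_mul 2).mul_const C) ?_
  · exact .of_forall fun b => (stronglyMeasurable_integral_kernel_pow_mul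
      (hf.aestronglyMeasurable measurableSet_simplex) b 2).aestronglyMeasurable.const_mul _
  · filter_upwards [self_mem_nhdsWithin,
      (tendsto_normFactor d).eventually (eventually_le_nhds one_lt_two)] with b hb hnorm
    filter_upwards [ae_simplex_pos_and_l1_lt_one] with s hs
    refine (abs_sqrt_pow_mul_secondMoment_le hC hs.1 hs.2 hb).trans ?_
    have := psi_pos hs.1 hs.2
    gcongr
  · exact ae_simplex_pos_and_l1_lt_one.mono fun s hs =>
      tendsto_sqrt_pow_mul_secondMoment hf hs.1 hs.2

/-! ### The integrated squared bias -/

theorem aestronglyMeasurable_integral_kernelMeasure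
    (hf : AEStronglyMeasurable f (volume.restrict (simplex d))) {b : ℝ} (hb : 0 < b) :
    AEStronglyMeasurable (fun s => ∫ x, f x ∂(kernelMeasure s b))
      (volume.restrict (simplex d)) := by
  refine (stronglyMeasurable_integral_kernel_pow_mul hf b 1).aestronglyMeasurable.congr ?_
  filter_upwards [ae_restrict_mem measurableSet_simplex] with s hs
  simp only [kernelMeasure, integral_dirichletMeasure (coord_div_add_one_pos hs hb)
    (one_sub_l1_div_add_one_pos hs hb), pow_one]

theorem memLp_top_integral_kernelMeasure (hf : ContinuousOn f (simplex d)) {b : ℝ} (hb : 0 < b) :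
    MemLp (fun s => ∫ x, f x ∂(kernelMeasure s b)) ⊤ (volume.restrict (simplex d)) := by
  obtain ⟨C, -, hC⟩ := exists_abs_le_of_continuousOn_simplex hf
  exact memLp_top_of_bound (aestronglyMeasurable_integral_kernelMeasure
    (hf.aestronglyMeasurable measurableSet_simplex) hb) C
    ((ae_restrict_mem measurableSet_simplex).mono fun s hs =>
      abs_integral_kernelMeasure_le_of_forall_abs_le hs hb hC)

theorem memLp_top_of_continuousOn_simplex (hf : ContinuousOn f (simplex d)) :
    MemLp f ⊤ (volume.restrict (simplex d)) := by
  obtain ⟨C, -, hC⟩ := exists_abs_le_of_continuousOn_simplex hf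
  exact memLp_top_of_bound (hf.aestronglyMeasurable measurableSet_simplex) C
    ((ae_restrict_mem measurableSet_simplex).mono hC)

theorem integrableOn_sq_of_memLp_top (hf : MemLp f ⊤ (volume.restrict (simplex d))) :
    IntegrableOn (fun s => f s ^ 2) (simplex d) := by
  have : IsFiniteMeasure (volume.restrict (simplex d)) :=
    isFiniteMeasure_restrict.2 isCompact_simplex.measure_lt_top.ne
  exact (hf.mono_exponent le_top).integrable_sq

theorem integrableOn_sq_integral_kernelMeasure (hf : ContinuousOn f (simplex d)) {b : ℝ}
    (hb : 0 < b) : IntegrableOn (fun s => (∫ x, f x ∂(kernelMeasure s b)) ^ 2) (simplex d) :=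
  integrableOn_sq_of_memLp_top (memLp_top_integral_kernelMeasure hf hb)

theorem integrableOn_sq_bias (hf : ContinuousOn f (simplex d)) {b : ℝ} (hb : 0 < b) :
    IntegrableOn (fun s => (∫ x, f x ∂(kernelMeasure s b) - f s) ^ 2) (simplex d) :=
  integrableOn_sq_of_memLp_top
    ((memLp_top_integral_kernelMeasure hf hb).sub (memLp_top_of_continuousOn_simplex hf))

theorem integrableOn_sq_biasCoeff (hf : ContDiffOn ℝ 2 f (simplex d)) :
    IntegrableOn (fun s => biasCoeff f s ^ 2) (simplex d) :=
  ((continuousOn_biasCoeff hf).pow 2).integrableOn_compact isCompact_simplex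

theorem tendsto_integral_sq_bias_div_sq (hf : ContDiffOn ℝ 2 f (simplex d)) :
    Tendsto (fun b => (∫ s in simplex d, (∫ x, f x ∂(kernelMeasure s b) - f s) ^ 2) / b ^ 2)
      (𝓝[>] 0) (𝓝 (∫ s in simplex d, biasCoeff f s ^ 2)) := by
  obtain ⟨C, _, hC⟩ := exists_abs_bias_le hf
  have hfm := hf.continuousOn.aestronglyMeasurable (μ := volume) measurableSet_simplex
  simp only [← integral_div, ← div_pow]
  refine tendsto_integral_filter_of_dominated_convergence (fun _ => C ^ 2) ?_ ?_
    (integrableOn_const isCompact_simplex.measure_lt_top.ne) ?_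
  · refine eventually_mem_nhdsWithin.mono fun b hb => ?_
    simp only [div_eq_mul_inv]
    exact (((aestronglyMeasurable_integral_kernelMeasure hfm hb).sub hfm).mul_const b⁻¹).pow 2
  · refine eventually_mem_nhdsWithin.mono fun b (hb : 0 < b) => ?_
    filter_upwards [ae_restrict_mem measurableSet_simplex] with s hs
    rw [norm_pow, Real.norm_eq_abs, abs_div, abs_of_pos hb]
    gcongr
    exact (div_le_iff₀ hb).2 (hC s hs b hb)
  · exact (ae_restrict_mem measurableSet_simplex).mono fun s hs => (tendsto_bias_div hf hs).pow 2

end Integrals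

/-! ### The mean integrated squared error -/

theorem dirichletDensity_le {α : Fin d → ℝ} {β : ℝ} (hα : ∀ i, 1 ≤ α i) (hβ : 1 ≤ β)
    {x : Fin d → ℝ} (hx : x ∈ simplex d) :
    dirichletDensity α β x ≤ Real.Gamma (l1 α + β) / (Real.Gamma β * ∏ i, Real.Gamma (α i)) := by
  have hβ0 : 0 < β := one_pos.trans_le hβ
  have hΓ := (Real.Gamma_pos_of_pos (add_pos_of_nonneg_of_pos (l1_nonneg α) hβ0)).le
  have hΓβ := (Real.Gamma_pos_of_pos hβ0).le
  have hΓα : 0 ≤ ∏ i, Real.Gamma (α i) :=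
    Finset.prod_nonneg fun i _ => (Real.Gamma_pos_of_pos (one_pos.trans_le (hα i))).le
  have hpow (i : Fin d) : 0 ≤ x i ^ (α i - 1) :=
    Real.rpow_nonneg (coord_nonneg_of_mem_simplex hx i) _
  refine mul_le_of_le_one_right (div_nonneg hΓ (mul_nonneg hΓβ hΓα)) (mul_le_one₀ ?_ ?_ ?_)
  · exact Real.rpow_le_one (one_sub_l1_nonneg hx) (sub_le_self _ (l1_nonneg x)) (sub_nonneg.2 hβ)
  · exact Finset.prod_nonneg fun i _ => hpow i
  · exact Finset.prod_le_one (fun i _ => hpow i) fun i _ =>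
      Real.rpow_le_one (hx.1 i).1 (hx.1 i).2 (sub_nonneg.2 (hα i))

section Law

variable {Ω : Type*} [MeasurableSpace Ω] {P : Measure Ω}

theorem integral_sq_sub_const [IsProbabilityMeasure P] {Y : Ω → ℝ} (hY : MemLp Y 2 P) (c : ℝ) :
    ∫ ω, (Y ω - c) ^ 2 ∂P = Var[Y; P] + (∫ ω, Y ω ∂P - c) ^ 2 := by
  have hvar := variance_eq_sub (hY.sub (memLp_const c))
  rw [show Var[Y - fun _ => c; P] = Var[Y; P] from variance_sub_const hY.aestronglyMeasurable c]
    at hvar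
  simp only [Pi.pow_apply, Pi.sub_apply, integral_sub (hY.integrable one_le_two)
    (integrable_const c), integral_const, probReal_univ, one_smul] at hvar
  exact (sub_eq_iff_eq_add.1 hvar.symm)

section Average

variable [IsProbabilityMeasure P] {Y : ℕ → Ω → ℝ} (hY : ∀ k, MemLp (Y k) 2 P) {m : ℝ}
  (hm : ∀ k, ∫ ω, Y k ω ∂P = m) {n : ℕ} (hn : 1 ≤ n)

include hY hm hn

theorem integral_average :
    ∫ ω, 1 / (n : ℝ) * ∑ k ∈ Finset.range n, Y k ω ∂P = m := by
  rw [integral_const_mul, integral_finsetSum _ fun k _ => (hY k).integrable one_le_two]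
  simp only [hm, Finset.sum_const, Finset.card_range, nsmul_eq_mul]
  field_simp

theorem variance_average (hind : Pairwise fun i j => Y i ⟂ᵢ[P] Y j) {v : ℝ}
    (hv : ∀ k, ∫ ω, Y k ω ^ 2 ∂P = v) :
    Var[fun ω => 1 / (n : ℝ) * ∑ k ∈ Finset.range n, Y k ω; P] = (n : ℝ)⁻¹ * (v - m ^ 2) := by
  have hsum := IndepFun.variance_sum (s := Finset.range n) (fun k _ => hY k)
    (fun i _ j _ hij => hind hij)
  simp only [variance_eq_sub (hY _), Pi.pow_apply, hm, hv, Finset.sum_const, Finset.card_range,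
    nsmul_eq_mul, Finset.sum_fn] at hsum
  rw [variance_const_mul, hsum]
  field_simp

theorem integral_sq_average_sub (hind : Pairwise fun i j => Y i ⟂ᵢ[P] Y j) {v : ℝ}
    (hv : ∀ k, ∫ ω, Y k ω ^ 2 ∂P = v) (c : ℝ) :
    ∫ ω, (1 / (n : ℝ) * ∑ k ∈ Finset.range n, Y k ω - c) ^ 2 ∂P =
      (n : ℝ)⁻¹ * (v - m ^ 2) + (m - c) ^ 2 := by
  rw [integral_sq_sub_const ((memLp_finsetSum _ fun k _ => hY k).const_mul _),
    variance_average hY hm hn hind hv, integral_average hY hm hn]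

end Average

variable {f : (Fin d → ℝ) → ℝ}

theorem integral_eq_one_of_isProbabilityMeasure_densityMeasure
    (hf_nonneg : ∀ s ∈ simplex d, 0 ≤ f s) (hf : ContinuousOn f (simplex d))
    [IsProbabilityMeasure (densityMeasure f)] : ∫ s in simplex d, f s = 1 := by
  rw [integral_eq_lintegral_of_nonneg_ae
    ((ae_restrict_mem measurableSet_simplex).mono hf_nonneg)
    (hf.aestronglyMeasurable measurableSet_simplex), ← densityMeasure_univ, measure_univ,
    ENNReal.toReal_one]

theorem memLp_dirichletDensity_comp [IsFiniteMeasure P] {X : Ω → Fin d → ℝ}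
    (hX : HasLaw X (densityMeasure f) P) {α : Fin d → ℝ} {β : ℝ} (hα : ∀ i, 1 ≤ α i)
    (hβ : 1 ≤ β) (p : ENNReal) : MemLp (fun ω => dirichletDensity α β (X ω)) p P := by
  obtain ⟨C, hC⟩ : ∃ C, ∀ x ∈ simplex d, dirichletDensity α β x ≤ C :=
    ⟨_, fun x hx => dirichletDensity_le hα hβ hx⟩
  have hmem : ∀ᵐ ω ∂P, X ω ∈ simplex d :=
    ae_of_ae_map hX.aemeasurable (hX.map_eq ▸ ae_densityMeasure_mem_simplex f)
  refine MemLp.of_bound ((measurable_dirichletDensity _ _).comp_aemeasurable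
    hX.aemeasurable).aestronglyMeasurable C (hmem.mono fun ω hω => ?_)
  rw [Real.norm_of_nonneg (dirichletDensity_nonneg (fun i => one_pos.trans_le (hα i))
    (one_pos.trans_le hβ) hω)]
  exact hC _ hω

theorem memLp_kernel_comp [IsFiniteMeasure P] {X : Ω → Fin d → ℝ}
    (hX : HasLaw X (densityMeasure f) P) {s : Fin d → ℝ} (hs : s ∈ simplex d) {b : ℝ}
    (hb : 0 < b) (p : ENNReal) :
    MemLp (fun ω => dirichletDensity (fun i => s i / b + 1) ((1 - l1 s) / b + 1) (X ω)) p P :=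
  memLp_dirichletDensity_comp hX
    (fun i => le_add_of_nonneg_left (div_nonneg (coord_nonneg_of_mem_simplex hs i) hb.le))
    (le_add_of_nonneg_left (div_nonneg (one_sub_l1_nonneg hs) hb.le)) p

variable {X : ℕ → Ω → Fin d → ℝ} (hX_law : ∀ k, HasLaw (X k) (densityMeasure f) P)

include hX_law

theorem integrable_sq_estimator_sub [IsFiniteMeasure P] (n : ℕ) {b : ℝ} (hb : 0 < b)
    {s : Fin d → ℝ} (hs : s ∈ simplex d) :
    Integrable (fun ω => |estimator n b (fun k => X k ω) s - f s| ^ 2) P := by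
  simp only [sq_abs]
  have hmem : MemLp (fun ω => estimator n b (fun k => X k ω) s) 2 P :=
    (memLp_finsetSum _ fun k _ => memLp_kernel_comp (hX_law k) hs hb 2).const_mul _
  exact (hmem.sub (memLp_const (f s))).integrable_sq

variable [IsProbabilityMeasure P] (hX_indep : Pairwise fun i j => X i ⟂ᵢ[P] X j)
  (hf_nonneg : ∀ s ∈ simplex d, 0 ≤ f s) (hf : ContinuousOn f (simplex d)) {n : ℕ} (hn : 1 ≤ n)
  {b : ℝ} (hb : 0 < b)

include hX_indep hf_nonneg hf hn hb

theorem mse_eq {s : Fin d → ℝ} (hs : s ∈ simplex d) :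
    mse P X f n b s = (n : ℝ)⁻¹ * (secondMoment f b s - (∫ x, f x ∂(kernelMeasure s b)) ^ 2) +
      (∫ x, f x ∂(kernelMeasure s b) - f s) ^ 2 := by
  have hkernel := measurable_dirichletDensity (fun i => s i / b + 1) ((1 - l1 s) / b + 1)
  have hfm := (hf.aestronglyMeasurable (μ := volume) measurableSet_simplex).aemeasurable
  have hmean (h : (Fin d → ℝ) → ℝ) (hh : Measurable h) (k : ℕ) :
      ∫ ω, h (X k ω) ∂P = ∫ x in simplex d, h x * f x :=
    ((hX_law k).integral_comp hh.aestronglyMeasurable).trans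
      ((integral_densityMeasure hf_nonneg hfm h).trans (by simp only [mul_comm]))
  simp only [mse, estimator, sq_abs]
  refine integral_sq_average_sub (fun k => memLp_kernel_comp (hX_law k) hs hb 2) (fun k => ?_) hn
    (fun i j hij => (hX_indep hij).comp hkernel hkernel) (hmean _ (hkernel.pow_const 2)) _
  rw [hmean _ hkernel, kernelMeasure, integral_dirichletMeasure (coord_div_add_one_pos hs hb)
    (one_sub_l1_div_add_one_pos hs hb)]

theorem integrableOn_mse : IntegrableOn (mse P X f n b) (simplex d) :=
  IntegrableOn.congr_fun ((((integrableOn_secondMoment hf hb).sub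
    (integrableOn_sq_integral_kernelMeasure hf hb)).const_mul (n : ℝ)⁻¹).add
    (integrableOn_sq_bias hf hb))
    (fun _ hs => (mse_eq hX_law hX_indep hf_nonneg hf hn hb hs).symm) measurableSet_simplex

theorem mise_eq :
    mise P X f n b = (n : ℝ)⁻¹ * ((∫ s in simplex d, secondMoment f b s) -
      ∫ s in simplex d, (∫ x, f x ∂(kernelMeasure s b)) ^ 2) +
      ∫ s in simplex d, (∫ x, f x ∂(kernelMeasure s b) - f s) ^ 2 := by
  have hmoment := integrableOn_secondMoment hf hb
  have hsq := integrableOn_sq_integral_kernelMeasure hf hb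
  have hvar : IntegrableOn (fun s => (n : ℝ)⁻¹ *
      (secondMoment f b s - (∫ x, f x ∂(kernelMeasure s b)) ^ 2)) (simplex d) :=
    (hmoment.sub hsq).const_mul _
  rw [mise, setIntegral_congr_fun measurableSet_simplex fun s hs =>
    mse_eq hX_law hX_indep hf_nonneg hf hn hb hs,
    integral_add hvar (integrableOn_sq_bias hf hb), integral_const_mul, integral_sub hmoment hsq]

end Law

/-! ### The leading part of the error -/

theorem leading_one (d : ℕ) (A B b : ℝ) :
    leading d A B 1 b = b ^ (-((d : ℝ) / 2)) * A + b ^ 2 * B := by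
  rw [leading, Nat.cast_one, inv_one, one_mul]

theorem leading_eq_rpow_mul_leading_one (A B : ℝ) {n : ℕ} (hn : 1 ≤ n) {b : ℝ} (hb : 0 < b) :
    leading d A B n b = (n : ℝ) ^ (-(4 / ((d : ℝ) + 4))) *
      leading d A B 1 ((n : ℝ) ^ (2 / ((d : ℝ) + 4)) * b) := by
  have hn0 : (0 : ℝ) < n := by positivity
  have hvar : (n : ℝ)⁻¹ = (n : ℝ) ^ (-(4 / ((d : ℝ) + 4))) *
      ((n : ℝ) ^ (2 / ((d : ℝ) + 4))) ^ (-((d : ℝ) / 2)) := by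
    rw [← Real.rpow_mul hn0.le, ← Real.rpow_add hn0, ← Real.rpow_neg_one]
    congr 1
    field_simp
    ring
  have hbias : (n : ℝ) ^ (-(4 / ((d : ℝ) + 4))) * ((n : ℝ) ^ (2 / ((d : ℝ) + 4))) ^ 2 = 1 := by
    rw [← Real.rpow_natCast ((n : ℝ) ^ _), ← Real.rpow_mul hn0.le, ← Real.rpow_add hn0,
      show -(4 / ((d : ℝ) + 4)) + 2 / ((d : ℝ) + 4) * (2 : ℕ) = 0 by push_cast; ring,
      Real.rpow_zero]
  rw [leading_one, leading, hvar, Real.mul_rpow (by positivity) hb.le]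
  linear_combination -(b ^ 2 * B) * hbias

theorem tendsto_leading_one {a c u : ℕ → ℝ} {A B lam : ℝ} (hlam : lam ≠ 0)
    (ha : Tendsto a atTop (𝓝 A)) (hc : Tendsto c atTop (𝓝 B)) (hu : Tendsto u atTop (𝓝 lam)) :
    Tendsto (fun n => leading d (a n) (c n) 1 (u n)) atTop (𝓝 (leading d A B 1 lam)) := by
  simp only [leading_one]
  exact ((hu.rpow_const (Or.inl hlam)).mul ha).add ((hu.pow 2).mul hc)

theorem optBandwidth_eq_rpow_mul (d : ℕ) (A B : ℝ) (n : ℕ) :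
    optBandwidth d A B n = (n : ℝ) ^ (-(2 / ((d : ℝ) + 4))) * optBandwidth d A B 1 := by
  simp only [optBandwidth, Nat.cast_one, Real.one_rpow, one_mul]

theorem rpow_mul_optBandwidth (A B : ℝ) {n : ℕ} (hn : 1 ≤ n) :
    (n : ℝ) ^ (2 / ((d : ℝ) + 4)) * optBandwidth d A B n = optBandwidth d A B 1 := by
  have hn0 : (0 : ℝ) < n := by positivity
  rw [optBandwidth_eq_rpow_mul d A B n, ← mul_assoc, ← Real.rpow_add hn0, add_neg_cancel,
    Real.rpow_zero, one_mul]

section Leading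

variable {A B : ℝ} (hA : 0 < A) (hB : 0 < B)

include hA hB

theorem leading_pos {n : ℕ} {b : ℝ} (hb : 0 < b) : 0 < leading d A B n b := by
  unfold leading
  positivity

theorem abs_leading_sub_leading_le (A' B' : ℝ) (n : ℕ) {b : ℝ} (hb : 0 ≤ b) :
    |leading d A' B' n b - leading d A B n b| ≤
      (|A' - A| / A + |B' - B| / B) * leading d A B n b := by
  have hp : 0 ≤ (n : ℝ)⁻¹ * b ^ (-((d : ℝ) / 2)) := by positivity
  have hq : 0 ≤ b ^ 2 := sq_nonneg b
  simp only [leading]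
  set p := (n : ℝ)⁻¹ * b ^ (-((d : ℝ) / 2))
  set q := b ^ 2
  have hcross : 0 ≤ |A' - A| / A * (q * B) + |B' - B| / B * (p * A) := by positivity
  calc |p * A' + q * B' - (p * A + q * B)| = |p * (A' - A) + q * (B' - B)| := by ring_nf
    _ ≤ p * |A' - A| + q * |B' - B| := by
      simpa only [abs_mul, abs_of_nonneg hp, abs_of_nonneg hq] using
        abs_add_le (p * (A' - A)) (q * (B' - B))
    _ ≤ p * |A' - A| + q * |B' - B| + (|A' - A| / A * (q * B) + |B' - B| / B * (p * A)) :=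
      le_add_of_nonneg_right hcross
    _ = (|A' - A| / A + |B' - B| / B) * (p * A + q * B) := by
      field_simp
      ring

end Leading

theorem add_min_mul_log_sq_le_rpow_add_sq {k t : ℝ} (hk : 0 < k) (ht : 0 < t) :
    2 / k + 1 + min 2 k * Real.log t ^ 2 ≤ 2 / k * t ^ (-k) + t ^ 2 := by
  obtain ⟨w, rfl⟩ : ∃ w, t = Real.exp w := ⟨Real.log t, (Real.exp_log ht).symm⟩
  rw [Real.log_exp, ← Real.exp_mul, ← Real.exp_nat_mul, Nat.cast_two]
  have hk2 : 0 ≤ 2 / k := by positivity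
  rcases le_total 0 w with hw | hw
  · calc 2 / k + 1 + min 2 k * w ^ 2 ≤ 2 / k + 1 + 2 * w ^ 2 := by
          gcongr
          exact min_le_left _ _
      _ = 2 / k * (w * -k + 1) + (1 + 2 * w + (2 * w) ^ 2 / 2) := by
          field_simp
          ring
      _ ≤ _ := add_le_add (mul_le_mul_of_nonneg_left (Real.add_one_le_exp _) hk2)
          (Real.quadratic_le_exp_of_nonneg (by positivity))
  · calc 2 / k + 1 + min 2 k * w ^ 2 ≤ 2 / k + 1 + k * w ^ 2 := by
          gcongr
          exact min_le_right _ _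
      _ = 2 / k * (1 + w * -k + (w * -k) ^ 2 / 2) + (2 * w + 1) := by
          field_simp
          ring
      _ ≤ _ := add_le_add (mul_le_mul_of_nonneg_left (Real.quadratic_le_exp_of_nonneg
          (mul_nonneg_of_nonpos_of_nonpos hw (neg_nonpos.2 hk.le))) hk2)
          (Real.add_one_le_exp _)

section OptBandwidth

variable {A B : ℝ} (hd : 1 ≤ d) (hA : 0 < A) (hB : 0 < B) {n : ℕ} (hn : 1 ≤ n)

include hd hA hB hn

theorem optBandwidth_pos : 0 < optBandwidth d A B n := by
  unfold optBandwidth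
  positivity

-- The derivative of `leading d A B n` vanishes at `optBandwidth d A B n`.
theorem optBandwidth_balance :
    (n : ℝ)⁻¹ * optBandwidth d A B n ^ (-((d : ℝ) / 2)) * A =
      4 / d * (optBandwidth d A B n ^ 2 * B) := by
  have hβ := optBandwidth_pos hd hA hB hn
  have hc : 0 < (d : ℝ) / 4 * (A / B) := by positivity
  have hpow : optBandwidth d A B n ^ (((d : ℝ) + 4) / 2) = (n : ℝ)⁻¹ * (d / 4 * (A / B)) := by
    rw [optBandwidth, Real.rpow_neg n.cast_nonneg, ← Real.inv_rpow n.cast_nonneg,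
      ← Real.mul_rpow (by positivity) hc.le, ← Real.rpow_mul (by positivity),
      div_mul_div_cancel₀ (by positivity), div_self two_ne_zero, Real.rpow_one]
  calc (n : ℝ)⁻¹ * optBandwidth d A B n ^ (-((d : ℝ) / 2)) * A
      = 4 / d * (optBandwidth d A B n ^ (-((d : ℝ) / 2)) *
          ((n : ℝ)⁻¹ * (d / 4 * (A / B)))) * B := by
        field_simp
    _ = 4 / d * (optBandwidth d A B n ^ 2 * B) := by
        rw [← hpow, ← Real.rpow_add hβ, ← Real.rpow_natCast (optBandwidth d A B n) 2, mul_assoc]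
        congr 3
        push_cast
        ring

theorem leading_mul_optBandwidth {t : ℝ} (ht : 0 < t) :
    leading d A B n (t * optBandwidth d A B n) = optBandwidth d A B n ^ 2 * B *
      (4 / d * t ^ (-((d : ℝ) / 2)) + t ^ 2) := by
  rw [leading, Real.mul_rpow ht.le (optBandwidth_pos hd hA hB hn).le]
  linear_combination t ^ (-((d : ℝ) / 2)) * optBandwidth_balance hd hA hB hn

theorem leading_optBandwidth :
    leading d A B n (optBandwidth d A B n) = optBandwidth d A B n ^ 2 * B * (4 / d + 1) := by
  simpa only [one_mul, Real.one_rpow, mul_one, one_pow] using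
    leading_mul_optBandwidth hd hA hB hn one_pos

theorem leading_optBandwidth_mul_le_leading {b : ℝ} (hb : 0 < b) :
    leading d A B n (optBandwidth d A B n) *
      (1 + min 2 ((d : ℝ) / 2) / (4 / d + 1) * Real.log (b / optBandwidth d A B n) ^ 2) ≤
      leading d A B n b := by
  have hβ := optBandwidth_pos hd hA hB hn
  have hd0 : (0 : ℝ) < d := by positivity
  have hgrowth := add_min_mul_log_sq_le_rpow_add_sq (half_pos hd0) (div_pos hb hβ)
  rw [← div_mul, div_mul_eq_mul_div, show (2 : ℝ) * 2 = 4 by norm_num] at hgrowth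
  set w := Real.log (b / optBandwidth d A B n)
  calc _ = optBandwidth d A B n ^ 2 * B * (4 / d + 1 + min 2 ((d : ℝ) / 2) * w ^ 2) := by
        rw [leading_optBandwidth hd hA hB hn]
        field_simp
    _ ≤ optBandwidth d A B n ^ 2 * B * (4 / d * (b / optBandwidth d A B n) ^ (-((d : ℝ) / 2)) +
          (b / optBandwidth d A B n) ^ 2) :=
        mul_le_mul_of_nonneg_left hgrowth (by positivity)
    _ = leading d A B n b := by
        rw [← leading_mul_optBandwidth hd hA hB hn (div_pos hb hβ), div_mul_cancel₀ _ hβ.ne']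

theorem leading_optBandwidth_lt {b : ℝ} (hb : 0 < b) (hne : b ≠ optBandwidth d A B n) :
    leading d A B n (optBandwidth d A B n) < leading d A B n b := by
  have hβ := optBandwidth_pos hd hA hB hn
  have hlog : Real.log (b / optBandwidth d A B n) ≠ 0 :=
    Real.log_ne_zero_of_pos_of_ne_one (div_pos hb hβ) (mt (div_eq_one_iff_eq hβ.ne').1 hne)
  refine lt_of_lt_of_le (lt_mul_of_one_lt_right (leading_pos hA hB hβ) ?_)
    (leading_optBandwidth_mul_le_leading hd hA hB hn hb)
  exact lt_add_of_pos_right _ (by positivity)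

theorem leading_optBandwidth_le {b : ℝ} (hb : 0 < b) :
    leading d A B n (optBandwidth d A B n) ≤ leading d A B n b := by
  rcases eq_or_ne b (optBandwidth d A B n) with rfl | hne
  · exact le_rfl
  · exact (leading_optBandwidth_lt hd hA hB hn hb hne).le

omit hn in
theorem leading_one_optBandwidth_one :
    leading d A B 1 (optBandwidth d A B 1) =
      ((1 + (d : ℝ) / 4) / ((d : ℝ) / 4) ^ ((d : ℝ) / ((d : ℝ) + 4))) *
        (A ^ (4 / ((d : ℝ) + 4)) / B ^ (-((d : ℝ) / ((d : ℝ) + 4)))) := by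
  have hc : 0 < (d : ℝ) / 4 := by positivity
  set q := 4 / ((d : ℝ) + 4) with hq
  have hexponent : (d : ℝ) / ((d : ℝ) + 4) = 1 - q := by
    rw [hq]
    field_simp
    ring
  have hsq : optBandwidth d A B 1 ^ 2 = ((d : ℝ) / 4) ^ q * (A ^ q / B ^ q) := by
    rw [optBandwidth, Nat.cast_one, Real.one_rpow, one_mul, ← Real.rpow_natCast,
      ← Real.rpow_mul (by positivity), ← Real.div_rpow hA.le hB.le,
      ← Real.mul_rpow hc.le (by positivity), hq]
    congr 1
    push_cast
    ring
  rw [leading_optBandwidth hd hA hB le_rfl, hsq, hexponent, Real.rpow_neg hB.le,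
    Real.rpow_sub hB, Real.rpow_sub hc, Real.rpow_one, Real.rpow_one]
  have := Real.rpow_pos_of_pos hc q
  field_simp

end OptBandwidth

/-! ### Criteria with a two-term expansion -/

/-- The error criterion `M n b` has the expansion
`n⁻¹ b^{-d/2} A + b² B + o(n⁻¹ b^{-d/2}) + o(b²)` as `n → ∞` and `b → 0⁺` independently. -/
def HasExpansion (d : ℕ) (A B : ℝ) (M : ℕ → ℝ → ℝ) : Prop :=
  ∃ R₁ R₂ : ℕ × ℝ → ℝ,
    R₁ =o[atTop ×ˢ 𝓝[>] (0 : ℝ)] (fun p => (p.1 : ℝ)⁻¹ * p.2 ^ (-((d : ℝ) / 2))) ∧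
    R₂ =o[atTop ×ˢ 𝓝[>] (0 : ℝ)] (fun p => p.2 ^ 2) ∧
    ∀ (n : ℕ) (b : ℝ), 1 ≤ n → 0 < b →
      M n b = (n : ℝ)⁻¹ * b ^ (-((d : ℝ) / 2)) * A + b ^ 2 * B + R₁ (n, b) + R₂ (n, b)

theorem IsBandwidth.tendsto {b : ℕ → ℝ} (hb : IsBandwidth b) :
    Tendsto (fun n => (n, b n)) atTop (atTop ×ˢ 𝓝[>] (0 : ℝ)) :=
  tendsto_id.prodMk (tendsto_nhdsWithin_iff.2 ⟨hb.2, hb.1⟩)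

theorem isBandwidth_of_tendsto {b : ℕ → ℝ} {p lam : ℝ} (hp : 0 < p) (hlam : 0 < lam)
    (h : Tendsto (fun n : ℕ => (n : ℝ) ^ p * b n) atTop (𝓝 lam)) : IsBandwidth b := by
  constructor
  · filter_upwards [h.eventually (eventually_gt_nhds hlam)] with n hn
    exact pos_of_mul_pos_right hn (by positivity)
  · have hdecay : Tendsto (fun n : ℕ => (n : ℝ) ^ (-p)) atTop (𝓝 0) :=
      (tendsto_rpow_neg_atTop hp).comp tendsto_natCast_atTop_atTop
    rw [← zero_mul lam]
    refine (hdecay.mul h).congr' ?_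
    filter_upwards [eventually_ge_atTop 1] with n hn
    have hn0 : (0 : ℝ) < n := by positivity
    rw [← mul_assoc, ← Real.rpow_add hn0, neg_add_cancel, Real.rpow_zero, one_mul]

theorem tendsto_rpow_mul_optBandwidth (d : ℕ) (A B : ℝ) :
    Tendsto (fun n : ℕ => (n : ℝ) ^ (2 / ((d : ℝ) + 4)) * optBandwidth d A B n) atTop
      (𝓝 (optBandwidth d A B 1)) :=
  tendsto_const_nhds.congr' ((eventually_ge_atTop 1).mono fun _ hn =>
    (rpow_mul_optBandwidth A B hn).symm)

theorem isBandwidth_optBandwidth {A B : ℝ} (hd : 1 ≤ d) (hA : 0 < A) (hB : 0 < B) :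
    IsBandwidth (optBandwidth d A B) :=
  isBandwidth_of_tendsto (by positivity) (optBandwidth_pos hd hA hB le_rfl)
    (tendsto_rpow_mul_optBandwidth d A B)

theorem eventually_le_one_add_mul_of_isEquivalent {ι : Type*} {l : Filter ι} {u v u' v' : ι → ℝ}
    (huv : u ~[l] v) (huv' : u' ~[l] v') (hv : ∀ᶠ i in l, 0 < v i)
    (hvv' : ∀ᶠ i in l, v i ≤ v' i) {ε : ℝ} (hε : 0 < ε) :
    ∀ᶠ i in l, u i ≤ (1 + ε) * u' i := by
  set η := ε / (2 + ε) with hη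
  have hη0 : 0 < η := by positivity
  have hratio : 1 + η = (1 + ε) * (1 - η) := by
    rw [hη]
    field_simp
    ring
  filter_upwards [huv.isLittleO.def hη0, huv'.isLittleO.def hη0, hv, hvv'] with i hi hi' hvi hle
  simp only [Pi.sub_apply, Real.norm_eq_abs, abs_of_pos hvi, abs_of_pos (hvi.trans_le hle)]
    at hi hi'
  calc u i ≤ (1 + η) * v i := by linarith [(abs_le.1 hi).2]
    _ ≤ (1 + η) * v' i := by gcongr
    _ = (1 + ε) * ((1 - η) * v' i) := by rw [hratio, mul_assoc]
    _ ≤ (1 + ε) * u' i := by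
      gcongr
      linarith [(abs_le.1 hi').1]

theorem isEquivalent_of_tendsto_log_div {ι : Type*} {l : Filter ι} {u v : ι → ℝ}
    (hu : ∀ᶠ i in l, 0 < u i) (hv : ∀ᶠ i in l, 0 < v i)
    (h : Tendsto (fun i => Real.log (u i / v i)) l (𝓝 0)) : u ~[l] v := by
  refine (isEquivalent_iff_tendsto_one (hv.mono fun _ hi => hi.ne')).2 ?_
  rw [← Real.exp_zero]
  refine ((Real.continuous_exp.tendsto 0).comp h).congr' ?_
  filter_upwards [hu, hv] with i hui hvi using Real.exp_log (div_pos hui hvi)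

section Expansion

variable {A B : ℝ}

theorem isEquivalent_optBandwidth_of_leading (hd : 1 ≤ d) (hA : 0 < A) (hB : 0 < B) {b : ℕ → ℝ}
    (hb : ∀ᶠ n in atTop, 0 < b n)
    (h : (fun n => leading d A B n (b n)) ~[atTop]
      fun n => leading d A B n (optBandwidth d A B n)) : b ~[atTop] optBandwidth d A B := by
  have hβ := (isBandwidth_optBandwidth hd hA hB).1
  set κ := min 2 ((d : ℝ) / 2) / (4 / d + 1)
  have hκ0 : 0 < κ := by positivity
  have hratio := (isEquivalent_iff_tendsto_one
    (hβ.mono fun n hn => (leading_pos (d := d) hA hB (n := n) hn).ne')).1 h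
  have hsq : Tendsto (fun n => Real.log (b n / optBandwidth d A B n) ^ 2) atTop (𝓝 0) := by
    have hlim := (hratio.sub_const 1).div_const κ
    rw [sub_self, zero_div] at hlim
    refine squeeze_zero' (Eventually.of_forall fun n => sq_nonneg _) ?_ hlim
    filter_upwards [hβ, hb, eventually_ge_atTop 1] with n hβn hbn hn
    rw [le_div_iff₀' hκ0, le_sub_iff_add_le', Pi.div_apply,
      le_div_iff₀' (leading_pos hA hB hβn)]
    exact leading_optBandwidth_mul_le_leading hd hA hB hn hbn
  refine isEquivalent_of_tendsto_log_div hb hβ ((tendsto_zero_iff_abs_tendsto_zero _).2 ?_)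
  simpa only [Function.comp_def, Real.sqrt_sq_eq_abs, Real.sqrt_zero] using hsq.sqrt

namespace HasExpansion

variable {M : ℕ → ℝ → ℝ} (h : HasExpansion d A B M)

include h

theorem exists_eventually_eq_leading {b : ℕ → ℝ} (hb : IsBandwidth b) :
    ∃ a c : ℕ → ℝ, Tendsto a atTop (𝓝 A) ∧ Tendsto c atTop (𝓝 B) ∧
      ∀ᶠ n in atTop, M n (b n) = leading d (a n) (c n) n (b n) := by
  obtain ⟨R₁, R₂, hR₁, hR₂, hM⟩ := h
  have ha := (hR₁.comp_tendsto hb.tendsto).tendsto_div_nhds_zero.const_add A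
  have hc := (hR₂.comp_tendsto hb.tendsto).tendsto_div_nhds_zero.const_add B
  rw [add_zero] at ha hc
  refine ⟨_, _, ha, hc, ?_⟩
  filter_upwards [eventually_ge_atTop 1, hb.1] with n hn hbn
  have := Real.rpow_pos_of_pos hbn (-((d : ℝ) / 2))
  have hn0 : (n : ℝ) ≠ 0 := by positivity
  rw [hM n _ hn hbn, leading]
  simp only [Function.comp_apply]
  field_simp
  ring

theorem isLittleO_of_tendsto {b : ℕ → ℝ} {lam : ℝ} (hlam : 0 < lam)
    (hb : Tendsto (fun n : ℕ => (n : ℝ) ^ (2 / ((d : ℝ) + 4)) * b n) atTop (𝓝 lam)) :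
    (fun n : ℕ => M n (b n) - (n : ℝ) ^ (-(4 / ((d : ℝ) + 4))) * leading d A B 1 lam)
      =o[atTop] (fun n : ℕ => (n : ℝ) ^ (-(4 / ((d : ℝ) + 4)))) := by
  have hbw := isBandwidth_of_tendsto (by positivity) hlam hb
  obtain ⟨a, c, ha, hc, hM⟩ := h.exists_eventually_eq_leading hbw
  have hlim := tendsto_sub_nhds_zero_iff.2 (tendsto_leading_one (d := d) hlam.ne' ha hc hb)
  refine isLittleO_iff_exists_eq_mul.2 ⟨_, hlim, ?_⟩
  filter_upwards [hM, hbw.1, eventually_ge_atTop 1] with n hMn hbn hn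
  rw [hMn, leading_eq_rpow_mul_leading_one _ _ hn hbn, Pi.mul_apply]
  ring

theorem isLittleO_optBandwidth (hd : 1 ≤ d) (hA : 0 < A) (hB : 0 < B) :
    (fun n : ℕ => M n (optBandwidth d A B n) -
      (n : ℝ) ^ (-(4 / ((d : ℝ) + 4))) *
        ((1 + (d : ℝ) / 4) / ((d : ℝ) / 4) ^ ((d : ℝ) / ((d : ℝ) + 4))) *
        (A ^ (4 / ((d : ℝ) + 4)) / B ^ (-((d : ℝ) / ((d : ℝ) + 4)))))
      =o[atTop] (fun n : ℕ => (n : ℝ) ^ (-(4 / ((d : ℝ) + 4)))) := by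
  simpa only [leading_one_optBandwidth_one hd hA hB, mul_assoc] using
    h.isLittleO_of_tendsto (optBandwidth_pos hd hA hB le_rfl)
      (tendsto_rpow_mul_optBandwidth d A B)

theorem isEquivalent_leading (hA : 0 < A) (hB : 0 < B) {b : ℕ → ℝ} (hb : IsBandwidth b) :
    (fun n => M n (b n)) ~[atTop] fun n => leading d A B n (b n) := by
  obtain ⟨a, c, ha, hc, hM⟩ := h.exists_eventually_eq_leading hb
  have hlim : Tendsto (fun n => |a n - A| / A + |c n - B| / B) atTop (𝓝 0) := by
    simpa only [sub_self, abs_zero, zero_div, add_zero] using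
      ((ha.sub_const A).abs.div_const A).add ((hc.sub_const B).abs.div_const B)
  have hbound : ((fun n => M n (b n)) - fun n => leading d A B n (b n)) =O[atTop]
      fun n => (|a n - A| / A + |c n - B| / B) * leading d A B n (b n) := by
    refine .of_bound' ?_
    filter_upwards [hM, hb.1] with n hMn hbn
    rw [Pi.sub_apply, hMn]
    exact (abs_leading_sub_leading_le hA hB _ _ n hbn.le).trans (le_abs_self _)
  refine hbound.trans_isLittleO ?_
  simpa only [one_mul] using ((isLittleO_one_iff ℝ).2 hlim).mul_isBigO (isBigO_refl _ _)

theorem isAsymptoticallyOptimal (hd : 1 ≤ d) (hA : 0 < A) (hB : 0 < B) :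
    IsAsymptoticallyOptimal M (optBandwidth d A B) := by
  have hβ := isBandwidth_optBandwidth hd hA hB
  have hMβ := h.isEquivalent_leading hA hB hβ
  refine ⟨hβ, fun b hb => ⟨fun ε hε => ?_, fun hMM => ?_⟩⟩
  · refine eventually_le_one_add_mul_of_isEquivalent hMβ (h.isEquivalent_leading hA hB hb)
      (hβ.1.mono fun n hn => leading_pos hA hB hn) ?_ hε
    filter_upwards [hb.1, eventually_ge_atTop 1] with n hbn hn
    exact leading_optBandwidth_le hd hA hB hn hbn
  · exact isEquivalent_optBandwidth_of_leading hd hA hB hb.1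
      (((h.isEquivalent_leading hA hB hb).symm.trans hMM).trans hMβ)

end HasExpansion

end Expansion

/-! ### The expansion of the error -/

theorem rpow_neg_half_mul_sqrt_pow (d : ℕ) {b : ℝ} (hb : 0 < b) :
    b ^ (-((d : ℝ) / 2)) * √b ^ d = 1 := by
  rw [Real.sqrt_eq_rpow, ← Real.rpow_natCast, ← Real.rpow_mul hb.le, ← Real.rpow_add hb,
    show -((d : ℝ) / 2) + 1 / 2 * (d : ℝ) = 0 by ring, Real.rpow_zero]

theorem eventually_prod_nhdsGT_pos :
    ∀ᶠ p : ℕ × ℝ in atTop ×ˢ 𝓝[>] (0 : ℝ), 0 < p.2 :=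
  tendsto_snd.eventually eventually_mem_nhdsWithin

theorem isLittleO_inv_mul_rpow_of_tendsto {V : ℝ → ℝ} {A : ℝ}
    (hV : Tendsto (fun b => √b ^ d * V b) (𝓝[>] 0) (𝓝 A)) :
    (fun p : ℕ × ℝ => (p.1 : ℝ)⁻¹ * V p.2 - (p.1 : ℝ)⁻¹ * p.2 ^ (-((d : ℝ) / 2)) * A)
      =o[atTop ×ˢ 𝓝[>] (0 : ℝ)] fun p => (p.1 : ℝ)⁻¹ * p.2 ^ (-((d : ℝ) / 2)) := by
  refine isLittleO_iff_exists_eq_mul.2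
    ⟨_, (tendsto_sub_nhds_zero_iff.2 hV).comp tendsto_snd, ?_⟩
  filter_upwards [eventually_prod_nhdsGT_pos] with p hp
  simp only [Pi.mul_apply, Function.comp_apply]
  linear_combination -((p.1 : ℝ)⁻¹ * V p.2) * rpow_neg_half_mul_sqrt_pow d hp

theorem isLittleO_sq_of_tendsto {U : ℝ → ℝ} {B : ℝ}
    (hU : Tendsto (fun b => U b / b ^ 2) (𝓝[>] 0) (𝓝 B)) :
    (fun p : ℕ × ℝ => U p.2 - p.2 ^ 2 * B)
      =o[atTop ×ˢ 𝓝[>] (0 : ℝ)] fun p => p.2 ^ 2 := by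
  refine isLittleO_iff_exists_eq_mul.2
    ⟨_, (tendsto_sub_nhds_zero_iff.2 hU).comp tendsto_snd, ?_⟩
  filter_upwards [eventually_prod_nhdsGT_pos] with p hp
  simp only [Pi.mul_apply, Function.comp_apply]
  field_simp

variable {f : (Fin d → ℝ) → ℝ}

theorem tendsto_sqrt_pow_mul_integral_sq (hd : 1 ≤ d) (hf : ContinuousOn f (simplex d)) :
    Tendsto (fun b => √b ^ d * ∫ s in simplex d, (∫ x, f x ∂(kernelMeasure s b)) ^ 2) (𝓝[>] 0)
      (𝓝 0) := by
  obtain ⟨C, -, hC⟩ := exists_abs_le_of_continuousOn_simplex hf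
  have hsqrt : Tendsto (fun b : ℝ => √b ^ d) (𝓝[>] 0) (𝓝 0) := by
    have hcont := (Real.continuous_sqrt.pow d).tendsto 0
    rw [Pi.pow_apply, Real.sqrt_zero, zero_pow (by lia)] at hcont
    exact hcont.mono_left nhdsWithin_le_nhds
  have hlim := hsqrt.mul_const (C ^ 2 * volume.real (simplex d))
  rw [zero_mul] at hlim
  refine squeeze_zero_norm' (eventually_mem_nhdsWithin.mono fun b (hb : 0 < b) => ?_) hlim
  rw [norm_mul, norm_pow, Real.norm_of_nonneg (Real.sqrt_nonneg b)]
  gcongr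
  refine norm_setIntegral_le_of_norm_le_const isCompact_simplex.measure_lt_top fun s hs => ?_
  rw [norm_pow]
  gcongr
  exact abs_integral_kernelMeasure_le_of_forall_abs_le hs hb hC

theorem hasExpansion_mise (hd : 1 ≤ d) {Ω : Type*} [MeasurableSpace Ω] {P : Measure Ω}
    [IsProbabilityMeasure P] {X : ℕ → Ω → Fin d → ℝ}
    (hf_nonneg : ∀ s ∈ simplex d, 0 ≤ f s) (hf : ContDiffOn ℝ 2 f (simplex d))
    (hX_law : ∀ k, HasLaw (X k) (densityMeasure f) P)
    (hX_indep : Pairwise fun i j => X i ⟂ᵢ[P] X j) :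
    HasExpansion d (∫ s in simplex d, psi s * f s) (∫ s in simplex d, biasCoeff f s ^ 2)
      (mise P X f) := by
  have hvar := (tendsto_integral_secondMoment hf.continuousOn).sub
    (tendsto_sqrt_pow_mul_integral_sq hd hf.continuousOn)
  simp only [sub_zero, ← mul_sub] at hvar
  refine ⟨_, _, isLittleO_inv_mul_rpow_of_tendsto hvar,
    isLittleO_sq_of_tendsto (tendsto_integral_sq_bias_div_sq hf), fun n b hn hb => ?_⟩
  rw [mise_eq hX_law hX_indep hf_nonneg hf.continuousOn hn hb]
  ring

end DirichletKernel

theorem mainTheorem3_general {d : ℕ} (hd : 1 ≤ d)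
    {Ω : Type*} [MeasurableSpace Ω] (P : Measure Ω) [IsProbabilityMeasure P]
    (f : (Fin d → ℝ) → ℝ)
    (hf_nonneg : ∀ s ∈ DirichletKernel.simplex d, 0 ≤ f s)
    (hf : ContDiffOn ℝ 2 f (DirichletKernel.simplex d))
    (X : ℕ → Ω → Fin d → ℝ)
    (hX_meas : ∀ k, AEMeasurable (X k) P)
    (hX_indep : Pairwise fun i j => X i ⟂ᵢ[P] X j)
    (hX_law : ∀ k, P.map (X k) =
      (volume.restrict (DirichletKernel.simplex d)).withDensity
        (fun x => ENNReal.ofReal (f x)))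
    (A B : ℝ)
    (hA : A = ∫ s in DirichletKernel.simplex d, DirichletKernel.psi s * f s)
    (hB : B = ∫ s in DirichletKernel.simplex d, DirichletKernel.biasCoeff f s ^ 2) :
    IntegrableOn (fun s => DirichletKernel.psi s * f s) (DirichletKernel.simplex d) ∧
    IntegrableOn (fun s => DirichletKernel.biasCoeff f s ^ 2) (DirichletKernel.simplex d) ∧
    (∀ (n : ℕ) (b : ℝ), 1 ≤ n → 0 < b →
      (∀ s ∈ DirichletKernel.simplex d,
        Integrable (fun ω => |DirichletKernel.estimator n b (fun k => X k ω) s - f s| ^ 2) P) ∧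
      IntegrableOn (DirichletKernel.mse P X f n b) (DirichletKernel.simplex d)) ∧
    (∃ R₁ R₂ : ℕ × ℝ → ℝ,
      R₁ =o[atTop ×ˢ 𝓝[>] (0 : ℝ)]
        (fun p => (p.1 : ℝ)⁻¹ * p.2 ^ (-((d : ℝ) / 2))) ∧
      R₂ =o[atTop ×ˢ 𝓝[>] (0 : ℝ)] (fun p => p.2 ^ 2) ∧
      ∀ (n : ℕ) (b : ℝ), 1 ≤ n → 0 < b →
        DirichletKernel.mise P X f n b =
          (n : ℝ)⁻¹ * b ^ (-((d : ℝ) / 2)) * A + b ^ 2 * B + R₁ (n, b) + R₂ (n, b)) ∧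
    (0 < B →
      (∀ n : ℕ, 1 ≤ n → 0 < DirichletKernel.optBandwidth d A B n ∧
        ∀ b : ℝ, 0 < b → b ≠ DirichletKernel.optBandwidth d A B n →
          DirichletKernel.leading d A B n (DirichletKernel.optBandwidth d A B n) <
            DirichletKernel.leading d A B n b) ∧
      DirichletKernel.IsAsymptoticallyOptimal (DirichletKernel.mise P X f)
        (DirichletKernel.optBandwidth d A B) ∧
      (fun n : ℕ => DirichletKernel.mise P X f n (DirichletKernel.optBandwidth d A B n) -
          (n : ℝ) ^ (-(4 / ((d : ℝ) + 4))) *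
            ((1 + (d : ℝ) / 4) / ((d : ℝ) / 4) ^ ((d : ℝ) / ((d : ℝ) + 4))) *
            (A ^ (4 / ((d : ℝ) + 4)) / B ^ (-((d : ℝ) / ((d : ℝ) + 4)))))
        =o[atTop] (fun n : ℕ => (n : ℝ) ^ (-(4 / ((d : ℝ) + 4))))) ∧
    (∀ (b : ℕ → ℝ) (lam : ℝ), 0 < lam →
      Tendsto (fun n : ℕ => (n : ℝ) ^ (2 / ((d : ℝ) + 4)) * b n) atTop (𝓝 lam) →
      (fun n : ℕ => DirichletKernel.mise P X f n (b n) -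
          (n : ℝ) ^ (-(4 / ((d : ℝ) + 4))) * (lam ^ (-((d : ℝ) / 2)) * A + lam ^ 2 * B))
        =o[atTop] (fun n : ℕ => (n : ℝ) ^ (-(4 / ((d : ℝ) + 4))))) := by
  have hlaw (k : ℕ) : HasLaw (X k) (DirichletKernel.densityMeasure f) P :=
    ⟨hX_meas k, hX_law k⟩
  have := (hlaw 0).isProbabilityMeasure_iff.1 ‹_›
  have hcont := hf.continuousOn
  have hexp : DirichletKernel.HasExpansion d A B (DirichletKernel.mise P X f) :=
    hA ▸ hB ▸ DirichletKernel.hasExpansion_mise hd hf_nonneg hf hlaw hX_indep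
  have hA0 : 0 < A := hA ▸ DirichletKernel.integral_psi_mul_pos hf_nonneg hcont
    ((DirichletKernel.integral_eq_one_of_isProbabilityMeasure_densityMeasure hf_nonneg hcont).symm ▸
      one_pos)
  refine ⟨DirichletKernel.integrableOn_psi_mul hcont, DirichletKernel.integrableOn_sq_biasCoeff hf,
    fun n b hn hb => ⟨fun s hs => DirichletKernel.integrable_sq_estimator_sub hlaw n hb hs,
      DirichletKernel.integrableOn_mse hlaw hX_indep hf_nonneg hcont hn hb⟩,
    hexp, fun hB0 => ⟨fun n hn => ⟨DirichletKernel.optBandwidth_pos hd hA0 hB0 hn,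
      fun b hb hne => DirichletKernel.leading_optBandwidth_lt hd hA0 hB0 hn hb hne⟩,
      hexp.isAsymptoticallyOptimal hd hA0 hB0, hexp.isLittleO_optBandwidth hd hA0 hB0⟩,
    fun b lam hlam hb => ?_⟩
  simpa only [DirichletKernel.leading_one] using hexp.isLittleO_of_tendsto hlam hb

theorem mainTheorem3 {d : ℕ} (hd : 1 ≤ d)
    {Ω : Type*} [MeasurableSpace Ω] (P : Measure Ω) [IsProbabilityMeasure P]
    (f : (Fin d → ℝ) → ℝ)
    (hf_nonneg : ∀ s ∈ DirichletKernel.simplex d, 0 ≤ f s)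
    (hf : ContDiffOn ℝ 2 f (DirichletKernel.simplex d))
    (X : ℕ → Ω → Fin d → ℝ)
    (hX_meas : ∀ k, Measurable (X k))
    (hX_indep : iIndepFun X P)
    (hX_law : ∀ k, P.map (X k) =
      (volume.restrict (DirichletKernel.simplex d)).withDensity
        (fun x => ENNReal.ofReal (f x)))
    (A B : ℝ)
    (hA : A = ∫ s in DirichletKernel.simplex d, DirichletKernel.psi s * f s)
    (hB : B = ∫ s in DirichletKernel.simplex d, DirichletKernel.biasCoeff f s ^ 2) :
    -- all the integrals involved converge
    IntegrableOn (fun s => DirichletKernel.psi s * f s) (DirichletKernel.simplex d) ∧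
    IntegrableOn (fun s => DirichletKernel.biasCoeff f s ^ 2) (DirichletKernel.simplex d) ∧
    (∀ (n : ℕ) (b : ℝ), 1 ≤ n → 0 < b →
      (∀ s ∈ DirichletKernel.simplex d,
        Integrable (fun ω => |DirichletKernel.estimator n b (fun k => X k ω) s - f s| ^ 2) P) ∧
      IntegrableOn (DirichletKernel.mse P X f n b) (DirichletKernel.simplex d)) ∧
    -- the expansion as `n → ∞` and `b → 0`
    (∃ R₁ R₂ : ℕ × ℝ → ℝ,
      R₁ =o[atTop ×ˢ 𝓝[>] (0 : ℝ)]
        (fun p => (p.1 : ℝ)⁻¹ * p.2 ^ (-((d : ℝ) / 2))) ∧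
      R₂ =o[atTop ×ˢ 𝓝[>] (0 : ℝ)] (fun p => p.2 ^ 2) ∧
      ∀ (n : ℕ) (b : ℝ), 1 ≤ n → 0 < b →
        DirichletKernel.mise P X f n b =
          (n : ℝ)⁻¹ * b ^ (-((d : ℝ) / 2)) * A + b ^ 2 * B + R₁ (n, b) + R₂ (n, b)) ∧
    -- the optimal bandwidth and the optimal error
    (0 < B →
      (∀ n : ℕ, 1 ≤ n → 0 < DirichletKernel.optBandwidth d A B n ∧
        ∀ b : ℝ, 0 < b → b ≠ DirichletKernel.optBandwidth d A B n →
          DirichletKernel.leading d A B n (DirichletKernel.optBandwidth d A B n) <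
            DirichletKernel.leading d A B n b) ∧
      DirichletKernel.IsAsymptoticallyOptimal (DirichletKernel.mise P X f)
        (DirichletKernel.optBandwidth d A B) ∧
      (fun n : ℕ => DirichletKernel.mise P X f n (DirichletKernel.optBandwidth d A B n) -
          (n : ℝ) ^ (-(4 / ((d : ℝ) + 4))) *
            ((1 + (d : ℝ) / 4) / ((d : ℝ) / 4) ^ ((d : ℝ) / ((d : ℝ) + 4))) *
            (A ^ (4 / ((d : ℝ) + 4)) / B ^ (-((d : ℝ) / ((d : ℝ) + 4)))))
        =o[atTop] (fun n : ℕ => (n : ℝ) ^ (-(4 / ((d : ℝ) + 4))))) ∧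
    -- bandwidths of the optimal order
    (∀ (b : ℕ → ℝ) (lam : ℝ), 0 < lam →
      Tendsto (fun n : ℕ => (n : ℝ) ^ (2 / ((d : ℝ) + 4)) * b n) atTop (𝓝 lam) →
      (fun n : ℕ => DirichletKernel.mise P X f n (b n) -
          (n : ℝ) ^ (-(4 / ((d : ℝ) + 4))) * (lam ^ (-((d : ℝ) / 2)) * A + lam ^ 2 * B))
        =o[atTop] (fun n : ℕ => (n : ℝ) ^ (-(4 / ((d : ℝ) + 4))))) :=
  mainTheorem3_general hd P f hf_nonneg hf X (fun k => (hX_meas k).aemeasurable)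
    (fun _ _ hij => hX_indep.indepFun hij) hX_law A B hA hB
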